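/- Let $d,m\ge 0$ be integers and let $M$ be $\mathbb T^d=\mathbb R^d/2\pi\mathbb Z^d$ or $\mathbb R^d$. Let $V,W_1,\dots,W_m:M\to\mathbb R$ and consider the bilinear Schrödinger equation $$ i\partial_t\psi=\Big(-\Delta+V+\sum_{j=1}^m u_j(t)W_j\Big)\psi \ \text{ on } M,\qquad \psi(0)=\psi_0, $$ with piecewise constant controls $u:[0,T]\to\mathbb R^m$. Its solution $\psi(t;u,\psi_0)$ is obtained by composing the unitary propagators $e^{-i\tau H_a}$, where $\tau>0$ is the duration of a piece on which $u=a$ and $H_a$ is the closure in $L^2(M,\mathbb C)$ of $-\Delta+V+\sum_j a_jW_j$ on $C_c^\infty(M,\mathbb C)$. The solution is defined when each $H_a$ that occurs is self-adjoint. A unitary operator $L$ of $L^2(M,\mathbb C)$ is called $L^2$-STAR if for every $\psi_0\in L^2(M,\mathbb C)$ with $\|\psi_0\|_{L^2}=1$ and every $\varepsilon>0$ there are $T\in[0,\varepsilon]$, $\theta\in[0,2\pi)$ and a piecewise constant $u:[0,T]\to\mathbb R^m$ whose solution $\psi(\cdot;u,\psi_0)$ is defined on $[0,T]$, such that $\|\psi(T;u,\psi_0)-e^{i\theta}L\psi_0\|_{L^2}<\varepsilon$.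 Let $\mathrm{Vec}(M)$ be the space of globally Lipschitz smooth vector fields on $M$. Write $\phi_f^t$ for the flow of a vector field $f$, $[f,g]=(Dg)f-(Df)g$, and $\mathcal L_P\psi=|J_P|^{1/2}(\psi\circ P)$ for a diffeomorphism $P$ of $M$ with Jacobian determinant $J_P$. Let $$\mathfrak L=\{f\in \mathrm{Vec}(M)\,:\,\mathcal L_{\phi_f^t}\text{ is }L^2\text{-STAR for all }t\in\mathbb R\}.$$ Then $\mathfrak L$ is a real vector subspace of $\mathrm{Vec}(M)$ that is stable under the Lie bracket, in the following sense. 1. If $M=\mathbb T^d$, then $[f,g]\in\mathfrak L$ for all $f,g\in\mathfrak L$, so that $\mathfrak L$ is a Lie subalgebra of $\mathrm{Vec}(\mathbb T^d)$. 2. If $M=\mathbb R^d$, then for all $f,g\in\mathfrak L$ the vector field $[f,g]$ has a global flow and $\mathcal L_{\phi_{[f,g]}^t}$ is a unitary $L^2$-STAR operator for every $t\in\mathbb R$. In particular $[f,g]\in\mathfrak L$ whenever $[f,g]\in\mathrm{Vec}(\mathbb R^d)$. -/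

import Mathlib

open MeasureTheory Filter Topology Real
open scoped ContDiff

noncomputable section

/-! ### The two flat manifolds `ℝᵈ` and `𝕋ᵈ = ℝᵈ / 2πℤᵈ`

Both are flat abelian groups `M` with an exponential map `e : ℝᵈ → M` (the identity, resp. the
quotient map). The chart of `M` around `y` is `v ↦ y + e v`; differential operators at `y` are
computed in this chart at `v = 0`. -/

/-- Euclidean space `ℝᵈ`. -/
abbrev Eucl (d : ℕ) : Type := EuclideanSpace ℝ (Fin d)

instance factTwoPiPos : Fact (0 < 2 * π) := ⟨Real.two_pi_pos⟩

/-- The torus `𝕋ᵈ = ℝᵈ / 2πℤᵈ`, with its product topology, metric and Lebesgue measure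
(of total mass `(2π)ᵈ`). -/
abbrev Torus (d : ℕ) : Type := Fin d → AddCircle (2 * π)

/-- The quotient map `ℝᵈ → 𝕋ᵈ`. -/
def torusExp (d : ℕ) (x : Eucl d) : Torus d := fun i => (x i : AddCircle (2 * π))

/-- The identity map of `ℝᵈ`, seen as the exponential map of the flat manifold `ℝᵈ`. -/
def euclExp (d : ℕ) (x : Eucl d) : Eucl d := x

section Flat

variable {d : ℕ} {M : Type} [AddCommGroup M] [PseudoMetricSpace M] [MeasureSpace M]

/-- A map on `M` is smooth. -/
def IsSmooth {G : Type} [NormedAddCommGroup G] [NormedSpace ℝ G] (e : Eucl d → M) (F : M → G) :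
    Prop :=
  ∀ y, ContDiff ℝ ∞ fun v : Eucl d => F (y + e v)

/-- The Laplace operator of the flat manifold `M`. -/
def flatLaplacian (e : Eucl d → M) (F : M → ℂ) (y : M) : ℂ :=
  Laplacian.laplacian (fun v : Eucl d => F (y + e v)) 0

/-- The map `P : M → M` is differentiable at `y`, with differential `A` (its Jacobian matrix). -/
def HasDiffAt (e : Eucl d → M) (P : M → M) (A : Eucl d →L[ℝ] Eucl d) (y : M) : Prop :=
  ∃ w : Eucl d → Eucl d, w 0 = 0 ∧ HasFDerivAt w A 0 ∧
    ∀ᶠ v in 𝓝 (0 : Eucl d), P (y + e v) = P y + e (w v)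

/-! ### Vector fields and flows -/

/-- `Vec(M)`: the globally Lipschitz smooth vector fields on `M`. -/
def LipVec (e : Eucl d → M) : Set (M → Eucl d) :=
  {f | IsSmooth e f ∧ ∃ K, LipschitzWith K f}

/-- The Lie bracket `[f, g] = (Dg) f - (Df) g`. -/
def bracket (e : Eucl d → M) (f g : M → Eucl d) (y : M) : Eucl d :=
  fderiv ℝ (fun v : Eucl d => g (y + e v)) 0 (f y) -
    fderiv ℝ (fun v : Eucl d => f (y + e v)) 0 (g y)

/-- The curve `γ : ℝ → M` solves `γ' = f ∘ γ`. (Every differentiable curve in `M` is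
`γ 0 + e ∘ c` for a differentiable curve `c` in `ℝᵈ`, and `γ'` is then `c'`.) -/
def IsSolODE (e : Eucl d → M) (f : M → Eucl d) (γ : ℝ → M) : Prop :=
  ∃ c : ℝ → Eucl d, (∀ t, γ t = γ 0 + e (c t)) ∧ ∀ t, HasDerivAt c (f (γ t)) t

/-- `φ t` is the flow `φ_f^t` of the vector field `f`, defined for all times on all of `M`. -/
def IsFlow (e : Eucl d → M) (f : M → Eucl d) (φ : ℝ → M → M) : Prop :=
  ∀ x, φ 0 x = x ∧ IsSolODE e f fun t => φ t x

/-! ### `L²` and the unitary action of diffeomorphisms -/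

/-- `L²(M, ℂ)`. -/
abbrev LTwo (M : Type) [MeasureSpace M] : Type := Lp ℂ 2 (volume : Measure M)

/-- The unitary operator `L` of `L²(M, ℂ)` is `𝓛_P : ψ ↦ |J_P|^{1/2} (ψ ∘ P)`, where `J_P` is the
Jacobian determinant of `P`. -/
def IsTransport (e : Eucl d → M) (P : M → M) (L : LTwo M ≃ₗᵢ[ℂ] LTwo M) : Prop :=
  ∃ A : M → Eucl d →L[ℝ] Eucl d, (∀ y, HasDiffAt e P (A y) y) ∧
    ∀ ψ : LTwo M, L ψ =ᵐ[volume] fun y => (Real.sqrt |(A y).det| : ℂ) * ψ (P y)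

/-! ### The Schrödinger equation with piecewise constant controls -/

/-- The graph in `L² × L²` of the operator `-Δ + Q` with domain `C_c^∞(M, ℂ)`. -/
def hamGraph (e : Eucl d → M) (Q : M → ℝ) : Set (LTwo M × LTwo M) :=
  {q | ∃ F : M → ℂ, IsSmooth e F ∧ HasCompactSupport F ∧ q.1 =ᵐ[volume] F ∧
    q.2 =ᵐ[volume] fun y => -flatLaplacian e F y + (Q y : ℂ) * F y}

/-- `U` is the strongly continuous one-parameter unitary group `t ↦ e^{-itH}`, where `H` is the
closure of `-Δ + Q` on `C_c^∞(M, ℂ)`: the infinitesimal generator of `U` is exactly `-iH`. Such a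
`U` is unique, and it exists if and only if `-Δ + Q` is essentially self-adjoint. -/
def IsPropagator (e : Eucl d → M) (Q : M → ℝ) (U : ℝ → LTwo M ≃ₗᵢ[ℂ] LTwo M) : Prop :=
  (∀ ψ, U 0 ψ = ψ) ∧ (∀ s t ψ, U (s + t) ψ = U s (U t ψ)) ∧ (∀ ψ, Continuous fun t => U t ψ) ∧
    ∀ ψ χ : LTwo M,
      HasDerivAt (fun t => U t ψ) (-Complex.I • χ) 0 ↔ (ψ, χ) ∈ closure (hamGraph e Q)

/-- A piecewise constant control with values in `ℝᵐ`: the list, in chronological order, of the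
durations of its pieces and of its values on them. -/
abbrev PWControl (m : ℕ) : Type := List (ℝ × (Fin m → ℝ))

/-- The total duration of a piecewise constant control. -/
def PWControl.duration {m : ℕ} (u : PWControl m) : ℝ := (u.map Prod.fst).sum

/-- `Evolves e V W u ψ₀ ψ₁`: the solution of `i ∂ₜψ = (-Δ + V + ∑ⱼ uⱼ(t) Wⱼ) ψ`, `ψ(0) = ψ₀`, with
the piecewise constant control `u` is well defined, and `ψ₁` is its value `ψ(T; u, ψ₀)` at the
final time `T`. -/
inductive Evolves {m : ℕ} (e : Eucl d → M) (V : M → ℝ) (W : Fin m → M → ℝ) :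
    PWControl m → LTwo M → LTwo M → Prop
  | nil (ψ : LTwo M) : Evolves e V W [] ψ ψ
  | cons (τ : ℝ) (a : Fin m → ℝ) (u : PWControl m) (U : ℝ → LTwo M ≃ₗᵢ[ℂ] LTwo M)
      (ψ₀ ψ₁ : LTwo M) (hτ : 0 < τ) (hU : IsPropagator e (fun y => V y + ∑ j, a j * W j y) U)
      (h : Evolves e V W u (U τ ψ₀) ψ₁) : Evolves e V W ((τ, a) :: u) ψ₀ ψ₁

/-- The unitary operator `L` is `L²`-STAR (small-time `L²`-approximately reachable). -/
def IsSTAR {m : ℕ} (e : Eucl d → M) (V : M → ℝ) (W : Fin m → M → ℝ)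
    (L : LTwo M ≃ₗᵢ[ℂ] LTwo M) : Prop :=
  ∀ ψ₀ : LTwo M, ‖ψ₀‖ = 1 → ∀ ε : ℝ, 0 < ε →
    ∃ T ∈ Set.Icc 0 ε, ∃ θ ∈ Set.Ico 0 (2 * π), ∃ u : PWControl m, u.duration = T ∧
      ∃ ψT, Evolves e V W u ψ₀ ψT ∧ ‖ψT - Complex.exp (θ * Complex.I) • L ψ₀‖ < ε

/-- The vector field `f` has a global flow `φ_f^t`, and for every `t ∈ ℝ` the unitary operator
`𝓛_{φ_f^t}` is (well defined and) `L²`-STAR. -/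
def HasSTARFlow {m : ℕ} (e : Eucl d → M) (V : M → ℝ) (W : Fin m → M → ℝ) (f : M → Eucl d) :
    Prop :=
  ∃ φ : ℝ → M → M, IsFlow e f φ ∧ ∀ t, ∃ L, IsTransport e (φ t) L ∧ IsSTAR e V W L

/-- The set `𝔏` of the `f ∈ Vec(M)` such that `𝓛_{φ_f^t}` is `L²`-STAR for all `t ∈ ℝ`. -/
def starFields {m : ℕ} (e : Eucl d → M) (V : M → ℝ) (W : Fin m → M → ℝ) :
    Set (M → Eucl d) :=
  {f | f ∈ LipVec e ∧ HasSTARFlow e V W f}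

end Flat

end

/-! The set of star fields is closed under any operation on vector fields that is realized, at the
level of flows, by limits of compositions.

`L²`-STAR operators are stable under composition, because evolutions are isometries, and under strong
limits (`IsSTAR.trans`, `IsSTAR.of_tendsto`). The flow of `f + g` at time `1` is the limit of
`(φ_g^{1/n} ∘ φ_f^{1/n})^n`, and the flow of `[f, g]` is the limit of
`(φ_g^{-h} ∘ φ_f^{-h} ∘ φ_g^h ∘ φ_f^h)^n` with `h = n^{-1/2}`; the flow at time `t` of a field `X` is
the flow at time `1` of `t X`, so that time `1` suffices. It remains to see that the operators
`𝓛_P` of these compositions converge strongly to that of the limit.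

* For this it is enough that the maps converge pointwise together with their first derivatives
  (`tendsto_transport`): then `𝓛_{P_n} ψ` converges pointwise for continuous `ψ`, with constant `L²`
  norm, hence in `L²`.
* Convergence of a product formula is the convergence of a consistent one-step method for an ordinary
  differential equation (`tendsto_iterate_of_consistent`), consistency being a Taylor expansion in
  time (`isLittleO_flow_comp_one`, `isLittleO_flow_commutator`). The same statement applied to the
  tangent lifts `(x, Y) ↦ (X x, DX(x) Y)`, whose flows are `(x, Y) ↦ (φ x, Dφ(x) Y)` and which respect
  sums and brackets (`lieBracket_tangentField`), gives the convergence of the derivatives.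
* The bracket of two globally Lipschitz fields has linear growth, whence its global flow
  (`TameField.exists_isGlobalFlow`), which is differentiable in the initial point
  (`IsGlobalFlow.hasDerivAt_fderiv`) and acts unitarily on `L²` (`IsCoverDiffeo.exists_isTransport`).

The manifolds `ℝᵈ` and `𝕋ᵈ` are treated together, as quotients of `ℝᵈ` by a discrete subgroup
(`IsFlatCover`): all differential equations are solved in `ℝᵈ`, and integrals over `M` are integrals
over a fundamental domain. -/

/-! ### Global flows of vector fields with linear growth -/

section GlobalFlows

open scoped Manifold NNReal

variable {E : Type*} [NormedAddCommGroup E] [NormedSpace ℝ E]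

/-- A vector field of class `C¹` and at most linear growth. -/
structure TameField (X : E → E) : Prop where
  contDiff : ContDiff ℝ 1 X
  growth : ∃ C, ∀ x, ‖X x‖ ≤ C * (1 + ‖x‖)

/-- `φ` is the flow of the vector field `X` on the normed space `E`, for all times and all
initial points. -/
def IsGlobalFlow (X : E → E) (φ : ℝ → E → E) : Prop :=
  ∀ x, φ 0 x = x ∧ ∀ t, HasDerivAt (fun s => φ s x) (X (φ t x)) t

lemma TameField.growth_pos {X : E → E} (hX : TameField X) :
    ∃ C, 0 < C ∧ ∀ x, ‖X x‖ ≤ C * (1 + ‖x‖) := by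
  obtain ⟨C, hC⟩ := hX.growth
  refine ⟨max C 1, by positivity, fun x => (hC x).trans ?_⟩
  gcongr
  exact le_max_left _ _

/-- A `C¹` map of a finite-dimensional space is Lipschitz on balls. -/
lemma ContDiff.exists_lipschitzOnWith_closedBall [FiniteDimensional ℝ E] {F : Type*}
    [NormedAddCommGroup F] [NormedSpace ℝ F] {X : E → F} (hX : ContDiff ℝ 1 X) (x : E) (r : ℝ) :
    ∃ K : ℝ≥0, LipschitzOnWith K X (Metric.closedBall x r) := by
  have hprop : ProperSpace E := FiniteDimensional.proper ℝ E
  obtain ⟨K, hK⟩ := (isCompact_closedBall x r).exists_bound_of_continuousOn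
    (hX.continuous_fderiv one_ne_zero).continuousOn
  refine ⟨K.toNNReal, (convex_closedBall x r).lipschitzOnWith_of_nnnorm_fderiv_le
    (fun y _ => (hX.differentiable one_ne_zero) y) fun y hy => ?_⟩
  rw [← NNReal.coe_le_coe, coe_nnnorm]
  exact (hK y hy).trans (le_coe_toNNReal K)

lemma integralCurve_unique [CompleteSpace E] {X : E → E} (hX : ContDiff ℝ 1 X) {γ γ' : ℝ → E}
    (h : ∀ t, HasDerivAt γ (X (γ t)) t) (h' : ∀ t, HasDerivAt γ' (X (γ' t)) t)
    (h0 : γ 0 = γ' 0) : γ = γ' :=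
  isMIntegralCurve_Ioo_eq_of_contMDiff_boundaryless (I := 𝓘(ℝ, E)) (v := X) (t₀ := 0)
    (contMDiff_vectorSpace_iff_contDiff.2 hX)
    (fun t => (h t).hasFDerivAt.hasMFDerivAt) (fun t => (h' t).hasFDerivAt.hasMFDerivAt) h0

/-- A tame vector field has a global flow. On the ball of radius `1 + ‖x‖` around `x` the field is
bounded by `2 C (1 + ‖x‖)`, so that the Picard-Lindelöf theorem gives a solution on an interval
whose length `1 / (2 C)` does not depend on `x`. -/
lemma TameField.exists_isGlobalFlow [FiniteDimensional ℝ E] {X : E → E} (hX : TameField X) :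
    ∃ φ, IsGlobalFlow X φ := by
  have hcomp : CompleteSpace E := FiniteDimensional.complete ℝ E
  obtain ⟨C, hC0, hC⟩ := hX.growth_pos
  have hloc : ∀ x : E, ∃ γ : ℝ → E, γ 0 = x ∧ IsMIntegralCurveOn (I := 𝓘(ℝ, E)) γ X
      (Set.Ioo (-(1 / (2 * C))) (1 / (2 * C))) := by
    intro x
    obtain ⟨K, hK⟩ := hX.contDiff.exists_lipschitzOnWith_closedBall x (1 + ‖x‖)
    have hε : 0 < 1 / (2 * C) := by positivity
    have hx0 : (0 : ℝ) ≤ 1 + ‖x‖ := by positivity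
    have hL0 : (0 : ℝ) ≤ 2 * C * (1 + ‖x‖) := by positivity
    have hpl : IsPicardLindelof (fun _ => X) (tmin := -(1 / (2 * C))) (tmax := 1 / (2 * C))
        ⟨0, by constructor <;> linarith⟩ x ⟨1 + ‖x‖, hx0⟩ 0 ⟨2 * C * (1 + ‖x‖), hL0⟩ K := by
      refine IsPicardLindelof.of_time_independent (fun y hy => ?_) hK ?_
      · have h1 : ‖y‖ ≤ ‖x‖ + (1 + ‖x‖) := by
          have : dist y x ≤ 1 + ‖x‖ := hy
          rw [dist_eq_norm] at this
          linarith [norm_le_norm_add_norm_sub' y x]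
        change ‖X y‖ ≤ 2 * C * (1 + ‖x‖)
        refine (hC y).trans ?_
        nlinarith
      · change 2 * C * (1 + ‖x‖) * max (1 / (2 * C) - 0) (0 - -(1 / (2 * C))) ≤ 1 + ‖x‖ - 0
        have : max (1 / (2 * C) - 0) (0 - -(1 / (2 * C))) = 1 / (2 * C) := by simp
        rw [this]
        apply le_of_eq
        field_simp
        ring
    obtain ⟨γ, hγ0, hγ⟩ := hpl.exists_eq_forall_mem_Icc_hasDerivWithinAt₀
    exact ⟨γ, hγ0, fun t ht =>
      ((hγ t (Set.Ioo_subset_Icc_self ht)).mono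
        Set.Ioo_subset_Icc_self).hasFDerivWithinAt.hasMFDerivWithinAt⟩
  have hglob := exists_isMIntegralCurve_of_isMIntegralCurveOn (I := 𝓘(ℝ, E)) (v := X)
    (contMDiff_vectorSpace_iff_contDiff.2 hX.contDiff) (by positivity : 0 < 1 / (2 * C)) hloc
  choose γ hγ0 hγ using hglob
  refine ⟨fun t x => γ x t, fun x => ⟨hγ0 x, fun t => ?_⟩⟩
  have hd : HasFDerivAt (γ x) ((1 : ℝ →L[ℝ] ℝ).smulRight (X (γ x t))) t :=
    hasMFDerivAt_iff_hasFDerivAt.1 (hγ x t)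
  simpa using hd.hasDerivAt

namespace IsGlobalFlow

variable {X : E → E} {φ : ℝ → E → E}

lemma zero (h : IsGlobalFlow X φ) (x : E) : φ 0 x = x := (h x).1

lemma hasDerivAt (h : IsGlobalFlow X φ) (x : E) (t : ℝ) :
    HasDerivAt (fun s => φ s x) (X (φ t x)) t := (h x).2 t

lemma unique [CompleteSpace E] (hX : ContDiff ℝ 1 X) (h : IsGlobalFlow X φ) {γ : ℝ → E}
    (hγ : ∀ t, HasDerivAt γ (X (γ t)) t) (t : ℝ) : γ t = φ t (γ 0) :=
  congrFun (integralCurve_unique hX hγ (fun t => h.hasDerivAt (γ 0) t) (h.zero _).symm) t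

lemma add [CompleteSpace E] (hX : ContDiff ℝ 1 X) (h : IsGlobalFlow X φ) (s t : ℝ) (x : E) :
    φ (s + t) x = φ s (φ t x) := by
  have := h.unique hX (γ := fun s => φ (s + t) x)
    (fun s => (h.hasDerivAt x (s + t)).comp_add_const s t) s
  simpa using this

lemma neg_apply [CompleteSpace E] (hX : ContDiff ℝ 1 X) (h : IsGlobalFlow X φ) (t : ℝ) (x : E) :
    φ (-t) (φ t x) = x := by
  rw [← h.add hX, neg_add_cancel, h.zero]

lemma apply_neg [CompleteSpace E] (hX : ContDiff ℝ 1 X) (h : IsGlobalFlow X φ) (t : ℝ) (x : E) :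
    φ t (φ (-t) x) = x := by
  rw [← h.add hX, add_neg_cancel, h.zero]

lemma smul (h : IsGlobalFlow X φ) (c : ℝ) : IsGlobalFlow (c • X) fun t x => φ (c * t) x := by
  refine fun x => ⟨by simp [h.zero], fun t => ?_⟩
  have := (h.hasDerivAt x (c * t)).scomp t ((hasDerivAt_id t).const_mul c)
  simpa [Function.comp_def] using this

/-- Grönwall's bound for the flow of a field with linear growth, for nonnegative times. -/
lemma norm_le_of_nonneg (h : IsGlobalFlow X φ) {C : ℝ} (hC0 : 0 < C)
    (hC : ∀ x, ‖X x‖ ≤ C * (1 + ‖x‖)) {t : ℝ} (ht : 0 ≤ t) (x : E) :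
    ‖φ t x‖ ≤ (1 + ‖x‖) * exp (C * t) := by
  have := norm_le_gronwallBound_of_norm_deriv_right_le (f := fun s => φ s x)
    (f' := fun s => X (φ s x)) (δ := ‖x‖) (K := C) (ε := C) (a := 0) (b := t)
    (fun s _ => (h.hasDerivAt x s).continuousAt.continuousWithinAt)
    (fun s _ => (h.hasDerivAt x s).hasDerivWithinAt) (by simp [h.zero])
    (fun s _ => (hC _).trans (by linarith)) t ⟨ht, le_rfl⟩
  refine this.trans ?_
  rw [gronwallBound_of_K_ne_0 hC0.ne', div_self hC0.ne', sub_zero]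
  linarith

lemma norm_le (h : IsGlobalFlow X φ) {C : ℝ} (hC0 : 0 < C)
    (hC : ∀ x, ‖X x‖ ≤ C * (1 + ‖x‖)) (t : ℝ) (x : E) :
    ‖φ t x‖ ≤ (1 + ‖x‖) * exp (C * |t|) := by
  rcases le_total 0 t with ht | ht
  · simpa [abs_of_nonneg ht] using h.norm_le_of_nonneg hC0 hC ht x
  · have := (h.smul (-1)).norm_le_of_nonneg hC0 (fun x => by simpa using hC x)
      (neg_nonneg.2 ht) x
    simpa [abs_of_nonpos ht] using this

/-- The flow is jointly continuous at time `0`. -/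
lemma tendsto_zero (h : IsGlobalFlow X φ) (hX : TameField X) (x : E) :
    Tendsto (fun p : ℝ × E => φ p.1 p.2) (𝓝 (0, x)) (𝓝 x) := by
  obtain ⟨C, hC0, hC⟩ := hX.growth_pos
  have hb : ∀ t y, ‖φ t y - y‖ ≤ C * (1 + (1 + ‖y‖) * exp (C * |t|)) * |t| := by
    intro t y
    have := (convex_uIcc (0 : ℝ) t).norm_image_sub_le_of_norm_hasDerivWithin_le
      (f := fun s => φ s y) (f' := fun s => X (φ s y))
      (C := C * (1 + (1 + ‖y‖) * exp (C * |t|)))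
      (fun s _ => (h.hasDerivAt y s).hasDerivWithinAt) (fun s hs => ?_)
      Set.left_mem_uIcc Set.right_mem_uIcc
    · simpa [h.zero] using this
    · refine (hC _).trans ?_
      gcongr
      have hst : |s| ≤ |t| := by simpa using Set.abs_sub_left_of_mem_uIcc hs
      exact (h.norm_le hC0 hC s y).trans (mul_le_mul_of_nonneg_left
        (exp_le_exp.2 (mul_le_mul_of_nonneg_left hst hC0.le)) (by positivity))
  have hg : Tendsto (fun p : ℝ × E => C * (1 + (1 + ‖p.2‖) * exp (C * |p.1|)) * |p.1|)
      (𝓝 (0, x)) (𝓝 0) := by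
    have : Continuous fun p : ℝ × E => C * (1 + (1 + ‖p.2‖) * exp (C * |p.1|)) * |p.1| := by
      fun_prop
    simpa using this.tendsto (0, x)
  have h0 := squeeze_zero_norm (fun p : ℝ × E => hb p.1 p.2) hg
  have h2 : Tendsto (fun p : ℝ × E => p.2) (𝓝 (0, x)) (𝓝 x) := (continuous_snd.tendsto (0, x))
  simpa using h0.add h2

end IsGlobalFlow

end GlobalFlows

/-! ### Differentiability of the flow in the initial point -/

section FlowDerivative

open scoped NNReal

variable {E : Type*} [NormedAddCommGroup E] [NormedSpace ℝ E]

lemma TameField.const_smul {X : E → E} (hX : TameField X) (c : ℝ) : TameField (c • X) := by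
  obtain ⟨C, hC⟩ := hX.growth
  refine ⟨hX.contDiff.const_smul c, |c| * C, fun x => ?_⟩
  rw [Pi.smul_apply, norm_smul, Real.norm_eq_abs, mul_assoc]
  gcongr
  exact hC x

/-- Solutions of a linear equation `Y' = A(t) Y` exist on every bounded interval: after cutting
`A` off in time, `(s, Y) ↦ (1, A(s) Y)` is a tame autonomous field. -/
lemma exists_linear_ode [FiniteDimensional ℝ E] {A : ℝ → E →L[ℝ] E} (hA : ContDiff ℝ 1 A)
    (T : ℝ) :
    ∃ Y : ℝ → E →L[ℝ] E, Y 0 = .id ℝ E ∧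
      ∀ t, |t| < T → HasDerivAt Y ((A t).comp (Y t)) t := by
  let χ : ContDiffBump (0 : ℝ) := ⟨max T 1, max T 1 + 1, by positivity, by linarith⟩
  let B : ℝ → E →L[ℝ] E := fun s => χ s • A s
  have hB : ContDiff ℝ 1 B := χ.contDiff.smul hA
  obtain ⟨C, hC⟩ := hB.continuous.bounded_above_of_compact_support
    (χ.hasCompactSupport.smul_right (f' := A))
  let Z : ℝ × (E →L[ℝ] E) → ℝ × (E →L[ℝ] E) := fun p => (1, (B p.1).comp p.2)
  have hZ : TameField Z := by
    refine ⟨contDiff_const.prodMk ((hB.comp contDiff_fst).clm_comp contDiff_snd), max C 1,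
      fun p => ?_⟩
    refine max_le ?_ ?_
    · rw [norm_one]
      nlinarith [le_max_right C 1, norm_nonneg p]
    · refine (ContinuousLinearMap.opNorm_comp_le _ _).trans ?_
      have h1 := norm_snd_le p
      have h2 := (hC p.1).trans (le_max_left C 1)
      have h3 := norm_nonneg (B p.1)
      nlinarith [norm_nonneg p.2, norm_nonneg p, le_max_right C 1]
  obtain ⟨Φ, hΦ⟩ := hZ.exists_isGlobalFlow
  have hd := fun t => hΦ.hasDerivAt (0, .id ℝ E) t
  have h1 : ∀ t, (Φ t (0, .id ℝ E)).1 = t := fun t => congrFun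
    (integralCurve_unique (X := fun _ : ℝ => (1 : ℝ)) contDiff_const (γ' := id)
      (fun t => (hd t).fst) (fun t => hasDerivAt_id t) (by simp [hΦ.zero])) t
  refine ⟨fun t => (Φ t (0, .id ℝ E)).2, by simp [hΦ.zero], fun t ht => ?_⟩
  have h2 : HasDerivAt (fun s => (Φ s (0, .id ℝ E)).2)
      ((B (Φ t (0, .id ℝ E)).1).comp (Φ t (0, .id ℝ E)).2) t := (hd t).snd
  have h3 : χ t = 1 := χ.one_of_mem_closedBall (by
    rw [mem_closedBall_zero_iff, Real.norm_eq_abs]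
    exact ht.le.trans (le_max_left _ _))
  simpa only [B, h1, h3, one_smul] using h2

/-- A `C¹` map is uniformly differentiable on balls. -/
lemma ContDiff.uniform_differentiability [FiniteDimensional ℝ E] {X : E → E}
    (hX : ContDiff ℝ 1 X) (R : ℝ) {ε : ℝ} (hε : 0 < ε) :
    ∃ δ > 0, ∀ a ∈ Metric.closedBall (0 : E) R, ∀ b ∈ Metric.closedBall (0 : E) R,
      ‖a - b‖ < δ → ‖X a - X b - fderiv ℝ X b (a - b)‖ ≤ ε * ‖a - b‖ := by
  have hprop : ProperSpace E := FiniteDimensional.proper ℝ E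
  have huc := (isCompact_closedBall (0 : E) R).uniformContinuousOn_of_continuous
    (hX.continuous_fderiv one_ne_zero).continuousOn
  obtain ⟨δ, hδ, h⟩ := Metric.uniformContinuousOn_iff.1 huc ε hε
  refine ⟨δ, hδ, fun a ha b hb hab => ?_⟩
  refine ((convex_closedBall (0 : E) R).inter
    (convex_ball b δ)).norm_image_sub_le_of_norm_hasFDerivWithin_le'
    (fun y _ => ((hX.differentiable one_ne_zero) y).hasFDerivAt.hasFDerivWithinAt)
    (fun y hy => ?_) ⟨hb, Metric.mem_ball_self hδ⟩ ⟨ha, by simpa [dist_eq_norm] using hab⟩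
  rw [← dist_eq_norm]
  exact (h y hy.1 b hb hy.2).le

namespace IsGlobalFlow

variable {X : E → E} {φ : ℝ → E → E}

/-- If `Y` solves the variational equation along the trajectory of `x`, then `Y 1` is the
derivative at `x` of the flow at time `1`. -/
lemma hasFDerivAt_one [FiniteDimensional ℝ E] (h : IsGlobalFlow X φ) (hX : TameField X) {x : E}
    {Y : ℝ → E →L[ℝ] E} (hY0 : Y 0 = .id ℝ E)
    (hY : ∀ t ∈ Set.Icc (0 : ℝ) 1, HasDerivAt Y ((fderiv ℝ X (φ t x)).comp (Y t)) t) :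
    HasFDerivAt (φ 1) (Y 1) x := by
  have hprop : ProperSpace E := FiniteDimensional.proper ℝ E
  obtain ⟨C, hC0, hC⟩ := hX.growth_pos
  set R := (2 + ‖x‖) * exp C with hR
  have hmem : ∀ y ∈ Metric.closedBall x 1, ∀ t ∈ Set.Icc (0 : ℝ) 1,
      φ t y ∈ Metric.closedBall (0 : E) R := by
    intro y hy t ht
    rw [mem_closedBall_zero_iff]
    refine (h.norm_le_of_nonneg hC0 hC ht.1 y).trans ?_
    rw [hR]
    have h1 : ‖y‖ ≤ ‖x‖ + 1 := by
      rw [mem_closedBall_iff_norm] at hy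
      linarith [norm_le_norm_add_norm_sub' y x]
    have h2 : C * t ≤ C := by nlinarith [ht.2]
    exact mul_le_mul (by linarith) (exp_le_exp.2 h2) (exp_pos _).le (by positivity)
  have hx1 : x ∈ Metric.closedBall x 1 := Metric.mem_closedBall_self zero_le_one
  obtain ⟨K₀, hK₀⟩ := (isCompact_closedBall (0 : E) R).exists_bound_of_continuousOn
    (hX.contDiff.continuous_fderiv one_ne_zero).continuousOn
  set K : ℝ := max K₀ 1 with hK
  have hK1 : 1 ≤ K := le_max_right _ _
  have hKpos : 0 < K := by linarith
  have hDX : ∀ z ∈ Metric.closedBall (0 : E) R, ‖fderiv ℝ X z‖ ≤ K := fun z hz =>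
    (hK₀ z hz).trans (le_max_left _ _)
  have hlip : ∀ a ∈ Metric.closedBall (0 : E) R, ∀ b ∈ Metric.closedBall (0 : E) R,
      ‖X a - X b‖ ≤ K * ‖a - b‖ := fun a ha b hb =>
    (convex_closedBall (0 : E) R).norm_image_sub_le_of_norm_fderiv_le
      (fun z _ => (hX.contDiff.differentiable one_ne_zero) z) hDX hb ha
  -- nearby trajectories separate at most exponentially
  have hsep : ∀ y ∈ Metric.closedBall x 1, ∀ t ∈ Set.Icc (0 : ℝ) 1,
      ‖φ t y - φ t x‖ ≤ ‖y - x‖ * exp K := by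
    intro y hy t ht
    have := norm_le_gronwallBound_of_norm_deriv_right_le (f := fun s => φ s y - φ s x)
      (f' := fun s => X (φ s y) - X (φ s x)) (δ := ‖y - x‖) (K := K) (ε := 0) (a := 0) (b := 1)
      (fun s _ => ((h.hasDerivAt y s).sub (h.hasDerivAt x s)).continuousAt.continuousWithinAt)
      (fun s _ => ((h.hasDerivAt y s).sub (h.hasDerivAt x s)).hasDerivWithinAt)
      (by simp [h.zero])
      (fun s hs => by
        have hs' := Set.Ico_subset_Icc_self hs
        simpa using hlip _ (hmem y hy s hs') _ (hmem x hx1 s hs')) t ht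
    refine this.trans ?_
    rw [gronwallBound_ε0]
    gcongr
    nlinarith [ht.2]
  refine HasFDerivAt.of_isLittleO (Asymptotics.isLittleO_iff.2 fun c hc => ?_)
  set ε := c * exp (-K) * exp (-K) with hε
  have hεpos : 0 < ε := by positivity
  obtain ⟨δ, hδ, hud⟩ := hX.contDiff.uniform_differentiability R hεpos
  have hnear : ∀ᶠ y in 𝓝 x, y ∈ Metric.closedBall x 1 ∧ ‖y - x‖ * exp K < δ := by
    refine Filter.Eventually.and (Metric.closedBall_mem_nhds x one_pos) ?_
    have : Tendsto (fun y => ‖y - x‖ * exp K) (𝓝 x) (𝓝 0) := by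
      have : Continuous fun y => ‖y - x‖ * exp K := by fun_prop
      simpa using this.tendsto x
    exact this.eventually_lt_const hδ
  filter_upwards [hnear] with y hy
  obtain ⟨hy1, hyδ⟩ := hy
  have hder : ∀ s ∈ Set.Icc (0 : ℝ) 1, HasDerivAt (fun s => φ s y - φ s x - Y s (y - x))
      (X (φ s y) - X (φ s x) - (fderiv ℝ X (φ s x)) (Y s (y - x))) s := fun s hs =>
    ((h.hasDerivAt y s).sub (h.hasDerivAt x s)).sub
      ((ContinuousLinearMap.apply ℝ E (y - x)).hasFDerivAt.comp_hasDerivAt s (hY s hs))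
  have := norm_le_gronwallBound_of_norm_deriv_right_le
    (f := fun s => φ s y - φ s x - Y s (y - x)) (δ := 0) (K := K)
    (ε := ε * (‖y - x‖ * exp K)) (a := 0) (b := 1)
    (fun s hs => (hder s hs).continuousAt.continuousWithinAt)
    (fun s hs => (hder s (Set.Ico_subset_Icc_self hs)).hasDerivWithinAt)
    (by simp [h.zero, hY0])
    (fun s hs => by
      have hs' := Set.Ico_subset_Icc_self hs
      have hsy := hsep y hy1 s hs'
      have hb := hud _ (hmem y hy1 s hs') _ (hmem x hx1 s hs') (hsy.trans_lt hyδ)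
      have hlin : X (φ s y) - X (φ s x) - (fderiv ℝ X (φ s x)) (Y s (y - x)) =
          fderiv ℝ X (φ s x) (φ s y - φ s x - Y s (y - x)) +
            (X (φ s y) - X (φ s x) - fderiv ℝ X (φ s x) (φ s y - φ s x)) := by
        rw [map_sub _ (φ s y - φ s x)]
        abel
      rw [hlin]
      refine (norm_add_le _ _).trans (add_le_add ?_ (hb.trans ?_))
      · exact ((fderiv ℝ X (φ s x)).le_opNorm _).trans
          (mul_le_mul_of_nonneg_right (hDX _ (hmem x hx1 s hs')) (norm_nonneg _))
      · exact mul_le_mul_of_nonneg_left hsy hεpos.le) 1 ⟨zero_le_one, le_rfl⟩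
  refine this.trans ?_
  rw [gronwallBound_of_K_ne_0 hKpos.ne']
  beta_reduce
  rw [zero_mul, zero_add, sub_zero, mul_one]
  have hee : exp (-K) * exp K = 1 := by rw [← exp_add]; simp
  have hval : ε * (‖y - x‖ * exp K) = c * ‖y - x‖ * exp (-K) := by
    rw [hε]
    linear_combination (c * exp (-K) * ‖y - x‖) * hee
  rw [hval]
  have h1 : c * ‖y - x‖ * exp (-K) / K ≤ c * ‖y - x‖ * exp (-K) :=
    div_le_self (by positivity) hK1
  calc c * ‖y - x‖ * exp (-K) / K * (exp K - 1)
      ≤ c * ‖y - x‖ * exp (-K) * exp K := by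
        refine mul_le_mul h1 (by linarith) ?_ (by positivity)
        linarith [add_one_le_exp K]
    _ = c * ‖y - x‖ := by rw [mul_assoc, hee, mul_one]

/-- The flow of a tame `C²` field is differentiable, and its derivative solves the variational
equation. -/
lemma exists_hasFDerivAt [FiniteDimensional ℝ E] (h : IsGlobalFlow X φ) (hX : TameField X)
    (hX2 : ContDiff ℝ 2 X) (x : E) (T : ℝ) :
    ∃ Y : ℝ → E →L[ℝ] E, ∀ t, |t| < T → HasFDerivAt (φ t) (Y t) x ∧
      HasDerivAt Y ((fderiv ℝ X (φ t x)).comp (Y t)) t := by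
  have hγ : ContDiff ℝ 1 fun t => φ t x := by
    rw [contDiff_one_iff_deriv]
    refine ⟨fun t => (h.hasDerivAt x t).differentiableAt, ?_⟩
    have : deriv (fun t => φ t x) = fun t => X (φ t x) := funext fun t => (h.hasDerivAt x t).deriv
    rw [this]
    exact hX2.continuous.comp (continuous_iff_continuousAt.2 fun t =>
      (h.hasDerivAt x t).continuousAt)
  have hA : ContDiff ℝ 1 fun t => fderiv ℝ X (φ t x) :=
    (hX2.fderiv_right (m := 1) (by norm_num)).comp hγ
  obtain ⟨Y, hY0, hY⟩ := exists_linear_ode hA T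
  refine ⟨Y, fun t ht => ⟨?_, hY t ht⟩⟩
  have := (h.smul t).hasFDerivAt_one (hX.const_smul t) (x := x) (Y := fun s => Y (t * s))
    (by simpa using hY0) (fun s hs => by
      have hts : |t * s| < T := by
        rw [abs_mul, abs_of_nonneg hs.1]
        nlinarith [hs.2, abs_nonneg t]
      have := (hY _ hts).scomp s ((hasDerivAt_id s).const_mul t)
      rw [fderiv_const_smul (hX2.differentiable two_ne_zero _)]
      simpa [Function.comp_def] using this)
  simpa using this

lemma differentiable [FiniteDimensional ℝ E] (h : IsGlobalFlow X φ) (hX : TameField X)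
    (hX2 : ContDiff ℝ 2 X) (t : ℝ) : Differentiable ℝ (φ t) := fun x => by
  obtain ⟨Y, hY⟩ := h.exists_hasFDerivAt hX hX2 x (|t| + 1)
  exact (hY t (by linarith)).1.differentiableAt

lemma hasDerivAt_fderiv [FiniteDimensional ℝ E] (h : IsGlobalFlow X φ) (hX : TameField X)
    (hX2 : ContDiff ℝ 2 X) (x : E) (t : ℝ) :
    HasDerivAt (fun s => fderiv ℝ (φ s) x)
      ((fderiv ℝ X (φ t x)).comp (fderiv ℝ (φ t) x)) t := by
  obtain ⟨Y, hY⟩ := h.exists_hasFDerivAt hX hX2 x (|t| + 1)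
  have ht := hY t (by linarith)
  rw [ht.1.fderiv]
  refine ht.2.congr_of_eventuallyEq ?_
  filter_upwards [(continuous_abs.tendsto t).eventually_lt_const (lt_add_one |t|)] with s hs
  exact (hY s hs).1.fderiv

end IsGlobalFlow

end FlowDerivative

/-! ### Product formulas and one-step methods -/

section ProductFormulas

open Asymptotics VectorField

variable {E : Type*} [NormedAddCommGroup E] [NormedSpace ℝ E]
variable {G : Type*} [NormedAddCommGroup G] [NormedSpace ℝ G]

/-- Integrating a little-o estimate in time, locally uniformly in the parameter. -/
lemma isLittleO_pow_succ_of_deriv {A : Type*} [PseudoMetricSpace A] {u u' : ℝ → A → G} {x : A}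
    {k : ℕ}
    (hu : ∀ s y, HasDerivAt (fun s => u s y) (u' s y) s) (hu0 : ∀ y, u 0 y = 0)
    (hu' : (fun p : ℝ × A => u' p.1 p.2) =o[𝓝 (0, x)] fun p => p.1 ^ k) :
    (fun p : ℝ × A => u p.1 p.2) =o[𝓝 (0, x)] fun p => p.1 ^ (k + 1) := by
  rw [isLittleO_iff] at hu' ⊢
  intro c hc
  obtain ⟨r, hr, hb⟩ := Metric.eventually_nhds_iff_ball.1 (hu' hc)
  refine Metric.eventually_nhds_iff_ball.2 ⟨r, hr, fun p hp => ?_⟩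
  rw [← ball_prod_same] at hb hp
  obtain ⟨hp1, hp2⟩ := hp
  rw [mem_ball_zero_iff, Real.norm_eq_abs] at hp1
  have := (convex_uIcc (0 : ℝ) p.1).norm_image_sub_le_of_norm_hasDerivWithin_le
    (f := fun s => u s p.2) (f' := fun s => u' s p.2) (C := c * |p.1| ^ k)
    (fun s _ => (hu s p.2).hasDerivWithinAt) (fun s hs => ?_)
    Set.left_mem_uIcc Set.right_mem_uIcc
  · simpa [hu0, pow_succ, mul_assoc] using this
  · have hs' : |s| ≤ |p.1| := by simpa using Set.abs_sub_left_of_mem_uIcc hs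
    refine (hb (s, p.2) ⟨?_, hp2⟩).trans ?_
    · rw [mem_ball_zero_iff, Real.norm_eq_abs]
      exact hs'.trans_lt hp1
    · rw [norm_pow, Real.norm_eq_abs]
      exact mul_le_mul_of_nonneg_left (pow_le_pow_left₀ (abs_nonneg s) hs' k) hc.le

namespace IsGlobalFlow

variable {X : E → E} {φ : ℝ → E → E}

/-- First-order expansion of an observable along a flow. -/
lemma isLittleO_observable (h : IsGlobalFlow X φ) (hX : Continuous X) {x : E}
    (hφ : Tendsto (fun p : ℝ × E => φ p.1 p.2) (𝓝 (0, x)) (𝓝 x))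
    {H : E → G} (hH : ContDiff ℝ 1 H) :
    (fun p : ℝ × E => H (φ p.1 p.2) - H p.2 - p.1 • fderiv ℝ H p.2 (X p.2))
      =o[𝓝 (0, x)] fun p => p.1 := by
  have hc : Continuous fun y => fderiv ℝ H y (X y) :=
    (hH.continuous_fderiv one_ne_zero).clm_apply hX
  have hsnd : Tendsto (fun p : ℝ × E => p.2) (𝓝 (0, x)) (𝓝 x) := continuous_snd.tendsto (0, x)
  have key := isLittleO_pow_succ_of_deriv (x := x) (k := 0)
    (u := fun s y => H (φ s y) - H y - s • fderiv ℝ H y (X y))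
    (u' := fun s y => fderiv ℝ H (φ s y) (X (φ s y)) - fderiv ℝ H y (X y))
    (fun s y => by
      have h1 := ((hH.differentiable one_ne_zero (φ s y)).hasFDerivAt.comp_hasDerivAt s
        (h.hasDerivAt y s)).sub_const (H y)
      have h2 := (hasDerivAt_id s).smul_const (fderiv ℝ H y (X y))
      simpa using h1.fun_sub h2)
    (fun y => by simp [h.zero])
    (by
      simp only [pow_zero]
      rw [isLittleO_one_iff]
      simpa using ((hc.tendsto x).comp hφ).sub ((hc.tendsto x).comp hsnd))
  simpa using key

lemma isLittleO_one (h : IsGlobalFlow X φ) (hX : Continuous X) {x : E}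
    (hφ : Tendsto (fun p : ℝ × E => φ p.1 p.2) (𝓝 (0, x)) (𝓝 x)) :
    (fun p : ℝ × E => φ p.1 p.2 - p.2 - p.1 • X p.2) =o[𝓝 (0, x)] fun p => p.1 := by
  simpa using h.isLittleO_observable hX hφ (H := fun y => y) contDiff_id

/-- Second-order Taylor expansion of a flow in time. -/
lemma isLittleO_two (h : IsGlobalFlow X φ) (hX : ContDiff ℝ 1 X) {x : E}
    (hφ : Tendsto (fun p : ℝ × E => φ p.1 p.2) (𝓝 (0, x)) (𝓝 x)) :
    (fun p : ℝ × E => φ p.1 p.2 - p.2 - p.1 • X p.2 - (p.1 ^ 2 / 2) • fderiv ℝ X p.2 (X p.2))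
      =o[𝓝 (0, x)] fun p => p.1 ^ 2 := by
  refine isLittleO_pow_succ_of_deriv (x := x) (k := 1)
    (u := fun s y => φ s y - y - s • X y - (s ^ 2 / 2) • fderiv ℝ X y (X y))
    (u' := fun s y => X (φ s y) - X y - s • fderiv ℝ X y (X y))
    (fun s y => ?_) (fun y => by simp [h.zero])
    (by simpa using h.isLittleO_observable hX.continuous hφ hX)
  have h1 := (h.hasDerivAt y s).sub_const y
  have h2 := (hasDerivAt_id s).smul_const (X y)
  have h3 := (((hasDerivAt_id s).pow 2).div_const 2).smul_const (fderiv ℝ X y (X y))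
  simpa using (h1.fun_sub h2).fun_sub h3

/-- Over a time `k = O(h)`, a flow displaces two points at distance `O(h²)` by the same amount,
up to `o(h²)`. -/
lemma isLittleO_sub_sub (h : IsGlobalFlow X φ) (hX : ContDiff ℝ 1 X) {x : E}
    (hφ : Tendsto (fun p : ℝ × E => φ p.1 p.2) (𝓝 (0, x)) (𝓝 x))
    {α : Type*} {l : Filter α} {k τ : α → ℝ} {a b : α → E} (hk : Tendsto k l (𝓝 0))
    (hkτ : k =O[l] τ) (ha : Tendsto a l (𝓝 x)) (hb : Tendsto b l (𝓝 x))
    (hab : (fun i => b i - a i) =O[l] fun i => τ i ^ 2) :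
    (fun i => φ (k i) (b i) - φ (k i) (a i) - (b i - a i)) =o[l] fun i => τ i ^ 2 := by
  have hτ2 : (fun i => k i ^ 2) =O[l] fun i => τ i ^ 2 := hkτ.pow 2
  have ea := ((h.isLittleO_two hX hφ).comp_tendsto (hk.prodMk_nhds ha)).trans_isBigO hτ2
  have eb := ((h.isLittleO_two hX hφ).comp_tendsto (hk.prodMk_nhds hb)).trans_isBigO hτ2
  have hXab : (fun i => X (b i) - X (a i)) =O[l] fun i => τ i ^ 2 :=
    ((hX.contDiffAt.hasStrictFDerivAt one_ne_zero).isBigO_sub.comp_tendsto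
      (hb.prodMk_nhds ha)).trans hab
  have e1 : (fun i => k i • (X (b i) - X (a i))) =o[l] fun i => τ i ^ 2 := by
    simpa using ((isLittleO_one_iff ℝ).2 hk).smul_isBigO hXab
  have hc : Continuous fun y => fderiv ℝ X y (X y) :=
    (hX.continuous_fderiv one_ne_zero).clm_apply hX.continuous
  have e2 : (fun i => (k i ^ 2 / 2) • (fderiv ℝ X (b i) (X (b i)) - fderiv ℝ X (a i) (X (a i))))
      =o[l] fun i => τ i ^ 2 := by
    have h0 : Tendsto (fun i => fderiv ℝ X (b i) (X (b i)) - fderiv ℝ X (a i) (X (a i))) l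
        (𝓝 0) := by
      simpa using ((hc.tendsto x).comp hb).sub ((hc.tendsto x).comp ha)
    have hk2 : (fun i => k i ^ 2 / 2) =O[l] fun i => τ i ^ 2 := by
      simpa [div_eq_inv_mul] using hτ2.const_mul_left (2⁻¹ : ℝ)
    simpa using hk2.smul_isLittleO ((isLittleO_one_iff ℝ).2 h0)
  refine (((eb.sub ea).add e1).add e2).congr_left fun i => ?_
  simp only [Function.comp_apply, smul_sub]
  abel

end IsGlobalFlow

variable {F₁ F₂ : E → E} {φ ψ : ℝ → E → E}

/-- Second-order expansion of the composition of two flows. -/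
lemma isLittleO_flow_comp (hφ : IsGlobalFlow F₁ φ) (hψ : IsGlobalFlow F₂ ψ)
    (hF₁ : ContDiff ℝ 1 F₁) (hF₂ : ContDiff ℝ 1 F₂) {x : E}
    (cφ : Tendsto (fun p : ℝ × E => φ p.1 p.2) (𝓝 (0, x)) (𝓝 x))
    (cψ : Tendsto (fun p : ℝ × E => ψ p.1 p.2) (𝓝 (0, x)) (𝓝 x)) :
    (fun p : ℝ × E => φ p.1 (ψ p.1 p.2) - (p.2 + p.1 • (F₁ p.2 + F₂ p.2) +
      (p.1 ^ 2 / 2) • (fderiv ℝ F₁ p.2 (F₁ p.2) + fderiv ℝ F₂ p.2 (F₂ p.2)) +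
      p.1 ^ 2 • fderiv ℝ F₁ p.2 (F₂ p.2))) =o[𝓝 (0, x)] fun p => p.1 ^ 2 := by
  have hfst : Tendsto (fun p : ℝ × E => p.1) (𝓝 (0, x)) (𝓝 0) := continuous_fst.tendsto (0, x)
  have hsnd : Tendsto (fun p : ℝ × E => p.2) (𝓝 (0, x)) (𝓝 x) := continuous_snd.tendsto (0, x)
  have e1 := hψ.isLittleO_two hF₂ cψ
  have e2 := (hφ.isLittleO_two hF₁ cφ).comp_tendsto (hfst.prodMk_nhds cψ)
  have e3 : (fun p : ℝ × E => p.1 • (F₁ (ψ p.1 p.2) - F₁ p.2 - p.1 • fderiv ℝ F₁ p.2 (F₂ p.2)))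
      =o[𝓝 (0, x)] fun p => p.1 ^ 2 := by
    simpa [pow_two] using (isBigO_refl (fun p : ℝ × E => p.1) (𝓝 (0, x))).smul_isLittleO
      (hψ.isLittleO_observable hF₂.continuous cψ hF₁)
  have hc : Continuous fun y => fderiv ℝ F₁ y (F₁ y) :=
    (hF₁.continuous_fderiv one_ne_zero).clm_apply hF₁.continuous
  have e4 : (fun p : ℝ × E => (p.1 ^ 2 / 2) •
      (fderiv ℝ F₁ (ψ p.1 p.2) (F₁ (ψ p.1 p.2)) - fderiv ℝ F₁ p.2 (F₁ p.2)))
      =o[𝓝 (0, x)] fun p => p.1 ^ 2 := by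
    have h0 : Tendsto (fun p : ℝ × E =>
        fderiv ℝ F₁ (ψ p.1 p.2) (F₁ (ψ p.1 p.2)) - fderiv ℝ F₁ p.2 (F₁ p.2)) (𝓝 (0, x))
        (𝓝 0) := by
      simpa using ((hc.tendsto x).comp cψ).sub ((hc.tendsto x).comp hsnd)
    have hk2 : (fun p : ℝ × E => p.1 ^ 2 / 2) =O[𝓝 (0, x)] fun p => p.1 ^ 2 := by
      simpa [div_eq_inv_mul] using
        (isBigO_refl (fun p : ℝ × E => p.1 ^ 2) (𝓝 (0, x))).const_mul_left (2⁻¹ : ℝ)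
    simpa using hk2.smul_isLittleO ((isLittleO_one_iff ℝ).2 h0)
  refine (((e1.add e2).add e3).add e4).congr_left fun p => ?_
  simp only [Function.comp_apply]
  module

/-- The commutator of two flows moves points by the Lie bracket of the fields, to second order.
With `A = φ_h ψ_h z` and `B = ψ_h φ_h z`, the commutator is the image of `B` under the map
`ψ_{-h} φ_{-h}`, which sends `A` to `z`; and `B - A` is `h²` times the bracket. -/
lemma isLittleO_flow_commutator [CompleteSpace E] (hφ : IsGlobalFlow F₁ φ)
    (hψ : IsGlobalFlow F₂ ψ) (hF₁ : ContDiff ℝ 1 F₁) (hF₂ : ContDiff ℝ 1 F₂) {x : E}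
    (cφ : Tendsto (fun p : ℝ × E => φ p.1 p.2) (𝓝 (0, x)) (𝓝 x))
    (cψ : Tendsto (fun p : ℝ × E => ψ p.1 p.2) (𝓝 (0, x)) (𝓝 x)) :
    (fun p : ℝ × E => ψ (-p.1) (φ (-p.1) (ψ p.1 (φ p.1 p.2))) - p.2 -
      p.1 ^ 2 • lieBracket ℝ F₁ F₂ p.2) =o[𝓝 (0, x)] fun p => p.1 ^ 2 := by
  have hfst : Tendsto (fun p : ℝ × E => p.1) (𝓝 (0, x)) (𝓝 0) := continuous_fst.tendsto (0, x)
  have hsnd : Tendsto (fun p : ℝ × E => p.2) (𝓝 (0, x)) (𝓝 x) := continuous_snd.tendsto (0, x)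
  have hneg : Tendsto (fun p : ℝ × E => -p.1) (𝓝 (0, x)) (𝓝 0) := by simpa using hfst.neg
  have hnegO : (fun p : ℝ × E => -p.1) =O[𝓝 (0, x)] fun p => p.1 := (isBigO_refl _ _).neg_left
  have cA : Tendsto (fun p : ℝ × E => φ p.1 (ψ p.1 p.2)) (𝓝 (0, x)) (𝓝 x) :=
    cφ.comp (hfst.prodMk_nhds cψ)
  have cB : Tendsto (fun p : ℝ × E => ψ p.1 (φ p.1 p.2)) (𝓝 (0, x)) (𝓝 x) :=
    cψ.comp (hfst.prodMk_nhds cφ)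
  have eBA : (fun p : ℝ × E => ψ p.1 (φ p.1 p.2) - φ p.1 (ψ p.1 p.2) -
      p.1 ^ 2 • lieBracket ℝ F₁ F₂ p.2) =o[𝓝 (0, x)] fun p => p.1 ^ 2 := by
    refine ((isLittleO_flow_comp hψ hφ hF₂ hF₁ cψ cφ).sub
      (isLittleO_flow_comp hφ hψ hF₁ hF₂ cφ cψ)).congr_left fun p => ?_
    simp only [lieBracket]
    module
  have hbr : Continuous fun y => lieBracket ℝ F₁ F₂ y :=
    ((hF₂.continuous_fderiv one_ne_zero).clm_apply hF₁.continuous).sub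
      ((hF₁.continuous_fderiv one_ne_zero).clm_apply hF₂.continuous)
  have hbrO : (fun p : ℝ × E => p.1 ^ 2 • lieBracket ℝ F₁ F₂ p.2) =O[𝓝 (0, x)]
      fun p => p.1 ^ 2 := by
    simpa using (isBigO_refl (fun p : ℝ × E => p.1 ^ 2) (𝓝 (0, x))).smul
      (((hbr.tendsto x).comp hsnd).isBigO_one ℝ)
  have OBA : (fun p : ℝ × E => ψ p.1 (φ p.1 p.2) - φ p.1 (ψ p.1 p.2)) =O[𝓝 (0, x)]
      fun p => p.1 ^ 2 := (eBA.isBigO.add hbrO).congr_left fun p => by abel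
  have e1 := hφ.isLittleO_sub_sub hF₁ cφ hneg hnegO cA cB OBA
  have OBA' : (fun p : ℝ × E => φ (-p.1) (ψ p.1 (φ p.1 p.2)) - φ (-p.1) (φ p.1 (ψ p.1 p.2)))
      =O[𝓝 (0, x)] fun p => p.1 ^ 2 := (e1.isBigO.add OBA).congr_left fun p => by abel
  have e2 := hψ.isLittleO_sub_sub hF₂ cψ hneg hnegO (cφ.comp (hneg.prodMk_nhds cA))
    (cφ.comp (hneg.prodMk_nhds cB)) OBA'
  refine ((e2.add e1).add eBA).congr_left fun p => ?_
  simp only [Function.comp_apply, hφ.neg_apply hF₁, hψ.neg_apply hF₂]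
  abel

/-- First-order expansion of the composition of two flows. -/
lemma isLittleO_flow_comp_one (hφ : IsGlobalFlow F₁ φ) (hψ : IsGlobalFlow F₂ ψ)
    (hF₁ : Continuous F₁) (hF₂ : Continuous F₂) {x : E}
    (cφ : Tendsto (fun p : ℝ × E => φ p.1 p.2) (𝓝 (0, x)) (𝓝 x))
    (cψ : Tendsto (fun p : ℝ × E => ψ p.1 p.2) (𝓝 (0, x)) (𝓝 x)) :
    (fun p : ℝ × E => ψ p.1 (φ p.1 p.2) - p.2 - p.1 • (F₁ + F₂) p.2)
      =o[𝓝 (0, x)] fun p => p.1 := by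
  have hfst : Tendsto (fun p : ℝ × E => p.1) (𝓝 (0, x)) (𝓝 0) := continuous_fst.tendsto (0, x)
  have hsnd : Tendsto (fun p : ℝ × E => p.2) (𝓝 (0, x)) (𝓝 x) := continuous_snd.tendsto (0, x)
  have e1 := hφ.isLittleO_one hF₁ cφ
  have e2 := (hψ.isLittleO_one hF₂ cψ).comp_tendsto (hfst.prodMk_nhds cφ)
  have e3 : (fun p : ℝ × E => p.1 • (F₂ (φ p.1 p.2) - F₂ p.2)) =o[𝓝 (0, x)] fun p => p.1 := by
    have h0 : Tendsto (fun p : ℝ × E => F₂ (φ p.1 p.2) - F₂ p.2) (𝓝 (0, x)) (𝓝 0) := by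
      simpa using ((hF₂.tendsto x).comp cφ).sub ((hF₂.tendsto x).comp hsnd)
    simpa using (isBigO_refl (fun p : ℝ × E => p.1) (𝓝 (0, x))).smul_isLittleO
      ((isLittleO_one_iff ℝ).2 h0)
  refine ((e1.add e2).add e3).congr_left fun p => ?_
  simp only [Function.comp_apply, Pi.add_apply, smul_add, smul_sub]
  abel

/-- Convergence of one-step methods: if the maps `S τ` agree with the flow of `X` to first order
as `τ → 0⁺`, locally uniformly, then `n` steps of duration `1 / n` lead along the trajectory of
`X`, in the limit, from its point at time `0` to its point at time `1`. -/
lemma tendsto_iterate_of_consistent [FiniteDimensional ℝ E] {X : E → E} (hX : ContDiff ℝ 1 X)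
    {p : ℝ → E} (hp : ∀ t, HasDerivAt p (X (p t)) t) {S : ℝ → E → E}
    (hS : ∀ x, ∀ c > 0, ∀ᶠ q : ℝ × E in 𝓝 (0, x), 0 ≤ q.1 →
      ‖S q.1 q.2 - q.2 - q.1 • X q.2‖ ≤ c * q.1) :
    Tendsto (fun n : ℕ => (S (1 / n))^[n] (p 0)) atTop (𝓝 (p 1)) := by
  have hprop : ProperSpace E := FiniteDimensional.proper ℝ E
  have hpc : Continuous p := continuous_iff_continuousAt.2 fun t => (hp t).continuousAt
  obtain ⟨R, hR⟩ := (isCompact_Icc (a := (0 : ℝ)) (b := 1)).exists_bound_of_continuousOn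
    hpc.continuousOn
  obtain ⟨L, hL⟩ := hX.exists_lipschitzOnWith_closedBall (0 : E) (R + 1)
  rw [Metric.tendsto_atTop']
  intro ε₀ hε₀
  set ε := min (ε₀ / 2) 1 with hε
  have hεpos : 0 < ε := by positivity
  have hε1 : ε ≤ 1 := min_le_right _ _
  have hεε₀ : ε < ε₀ := (min_le_left _ _).trans_lt (by linarith)
  set η := ε / 2 * exp (-L) with hη
  have hηpos : 0 < η := by positivity
  -- uniform consistency of `S` near the trajectory
  have hcons : ∀ᶠ τ in 𝓝 (0 : ℝ), ∀ z ∈ Metric.closedBall (0 : E) (R + 1), 0 ≤ τ →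
      ‖S τ z - z - τ • X z‖ ≤ η * τ :=
    (isCompact_closedBall (0 : E) (R + 1)).eventually_forall_of_forall_eventually
      fun z _ => hS z η hηpos
  obtain ⟨τ₁, hτ₁, hcons⟩ := Metric.eventually_nhds_iff.1 hcons
  -- the trajectory is uniformly differentiable
  have huc := (isCompact_Icc (a := (0 : ℝ)) (b := 1)).uniformContinuousOn_of_continuous
    (hX.continuous.comp hpc).continuousOn
  obtain ⟨τ₂, hτ₂, huc⟩ := Metric.uniformContinuousOn_iff.1 huc η hηpos
  have htraj : ∀ t τ, 0 ≤ t → 0 ≤ τ → t + τ ≤ 1 → τ < τ₂ →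
      ‖p (t + τ) - p t - τ • X (p t)‖ ≤ η * τ := by
    intro t τ ht hτ htτ hττ₂
    have := (convex_Icc t (t + τ)).norm_image_sub_le_of_norm_hasDerivWithin_le
      (f := fun s => p s - (s - t) • X (p t)) (f' := fun s => X (p s) - X (p t)) (C := η)
      (fun s _ => by
        have h1 := ((hasDerivAt_id s).sub_const t).smul_const (X (p t))
        simpa using ((hp s).fun_sub h1).hasDerivWithinAt)
      (fun s hs => by
        rw [← dist_eq_norm]
        refine (huc s ⟨ht.trans hs.1, hs.2.trans htτ⟩ t ⟨ht, by linarith⟩ ?_).le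
        rw [Real.dist_eq, abs_of_nonneg (by linarith [hs.1])]
        linarith [hs.2])
      (Set.left_mem_Icc.2 (by linarith)) (Set.right_mem_Icc.2 (by linarith))
    rw [Real.norm_eq_abs, add_sub_cancel_left, abs_of_nonneg hτ] at this
    refine le_trans (le_of_eq ?_) this
    congr 1
    simp only [sub_self, zero_smul, sub_zero]
    abel
  obtain ⟨N, hN⟩ := exists_nat_gt (1 / min τ₁ τ₂)
  refine ⟨N, fun n hn => ?_⟩
  have hmin : 0 < min τ₁ τ₂ := lt_min hτ₁ hτ₂
  have hnN : (N : ℝ) < n := by exact_mod_cast hn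
  have hn0 : (0 : ℝ) < n := lt_trans (by positivity) (hN.trans hnN)
  set τ : ℝ := 1 / n with hτ
  have hτ0 : 0 < τ := by positivity
  have hτmin : τ < min τ₁ τ₂ := by
    rw [hτ, one_div_lt hn0 hmin]
    exact hN.trans hnN
  have hnτ : n * τ = 1 := by rw [hτ]; field_simp
  have hgrow : ∀ k : ℕ, k ≤ n → 2 * η * τ * k * (1 + L * τ) ^ k ≤ ε := by
    intro k hk
    have hk' : (k : ℝ) ≤ n := by exact_mod_cast hk
    have h1 : (1 + L * τ) ^ k ≤ exp L := by
      calc (1 + L * τ) ^ k ≤ exp (L * τ) ^ k :=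
            pow_le_pow_left₀ (by positivity) (by linarith [add_one_le_exp (L * τ)]) k
        _ = exp (k * (L * τ)) := by rw [← exp_nat_mul]
        _ ≤ exp L := by
          apply exp_le_exp.2
          have : (k : ℝ) * τ ≤ 1 := by nlinarith
          nlinarith [NNReal.coe_nonneg L]
    have h2 : τ * k ≤ 1 := by nlinarith
    have h3 : exp (-(L : ℝ)) * exp L = 1 := by rw [← exp_add]; simp
    calc 2 * η * τ * k * (1 + L * τ) ^ k = 2 * η * (τ * k) * (1 + L * τ) ^ k := by ring
      _ ≤ 2 * η * 1 * exp L := by gcongr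
      _ = ε := by rw [hη]; linear_combination ε * h3
  have herr : ∀ k : ℕ, k ≤ n → ‖(S τ)^[k] (p 0) - p (k * τ)‖ ≤
      2 * η * τ * k * (1 + L * τ) ^ k := by
    intro k
    induction k with
    | zero => simp
    | succ k ih =>
      intro hk
      have hkn : k ≤ n := by lia
      have ih := ih hkn
      have hk1 : ((k : ℝ) + 1) ≤ n := by exact_mod_cast hk
      have hkτ : (k : ℝ) * τ + τ ≤ 1 := by nlinarith
      have hkτ0 : 0 ≤ (k : ℝ) * τ := by positivity
      set z := (S τ)^[k] (p 0) with hz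
      set w := p (k * τ) with hw
      have hwb : ‖w‖ ≤ R := hR _ ⟨hkτ0, by linarith⟩
      have hwmem : w ∈ Metric.closedBall (0 : E) (R + 1) := by
        rw [mem_closedBall_zero_iff]
        linarith
      have hzmem : z ∈ Metric.closedBall (0 : E) (R + 1) := by
        rw [mem_closedBall_zero_iff]
        linarith [norm_le_norm_add_norm_sub' z w, ih.trans (hgrow k hkn)]
      have h1 : ‖S τ z - z - τ • X z‖ ≤ η * τ := hcons (by
        rw [dist_zero_right, Real.norm_eq_abs, abs_of_pos hτ0]
        exact hτmin.trans_le (min_le_left _ _)) z hzmem hτ0.le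
      have h2 : ‖p (k * τ + τ) - w - τ • X w‖ ≤ η * τ :=
        htraj _ _ hkτ0 hτ0.le hkτ (hτmin.trans_le (min_le_right _ _))
      have h3 : ‖X z - X w‖ ≤ L * ‖z - w‖ := by
        simpa [dist_eq_norm] using hL.dist_le_mul z hzmem w hwmem
      rw [Function.iterate_succ_apply', ← hz]
      have hcast : ((k + 1 : ℕ) : ℝ) * τ = k * τ + τ := by push_cast; ring
      rw [hcast]
      have hsplit : S τ z - p (k * τ + τ) = (S τ z - z - τ • X z) -
          (p (k * τ + τ) - w - τ • X w) + (z - w) + τ • (X z - X w) := by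
        rw [smul_sub]; abel
      have h4 : ‖τ • (X z - X w)‖ ≤ τ * (L * ‖z - w‖) := by
        rw [norm_smul, Real.norm_eq_abs, abs_of_pos hτ0]
        gcongr
      have h5 : ‖S τ z - p (k * τ + τ)‖ ≤ η * τ + η * τ + ‖z - w‖ + τ * (L * ‖z - w‖) := by
        rw [hsplit]
        refine (norm_add_le _ _).trans (add_le_add ((norm_add_le _ _).trans (add_le_add
          ((norm_sub_le _ _).trans (add_le_add h1 h2)) le_rfl)) h4)
      have h6 : (1 + L * τ) * ‖z - w‖ ≤
          (1 + L * τ) * (2 * η * τ * k * (1 + L * τ) ^ k) := by gcongr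
      have h7 : 1 ≤ (1 + L * τ) ^ (k + 1) := one_le_pow₀ (by
        have : 0 ≤ L * τ := by positivity
        linarith)
      have h8 : 2 * η * τ ≤ 2 * η * τ * (1 + L * τ) ^ (k + 1) :=
        le_mul_of_one_le_right (by positivity) h7
      calc ‖S τ z - p (k * τ + τ)‖ ≤ 2 * η * τ + (1 + L * τ) * ‖z - w‖ := by linarith
        _ ≤ 2 * η * τ * (1 + L * τ) ^ (k + 1) +
            (1 + L * τ) * (2 * η * τ * k * (1 + L * τ) ^ k) := add_le_add h8 h6
        _ = _ := by push_cast; ring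
  have := (herr n le_rfl).trans (hgrow n le_rfl)
  rw [hnτ] at this
  rw [dist_eq_norm]
  exact this.trans_lt hεε₀

end ProductFormulas

/-! ### Tangent lifts and convergence of derivatives -/

section TangentLift

open Asymptotics VectorField

variable {E : Type*} [NormedAddCommGroup E] [NormedSpace ℝ E]

/-- The tangent lift of a vector field `X`: the field on `E × (E →L[ℝ] E)` whose trajectories are
those of `X` together with the solutions of the variational equation along them. -/
noncomputable def tangentField (X : E → E) (p : E × (E →L[ℝ] E)) : E × (E →L[ℝ] E) :=
  (X p.1, (fderiv ℝ X p.1).comp p.2)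

/-- The tangent lift of a map `P`, acting on matrices of tangent vectors. -/
noncomputable def tangentLift (P : E → E) (p : E × (E →L[ℝ] E)) : E × (E →L[ℝ] E) :=
  (P p.1, (fderiv ℝ P p.1).comp p.2)

lemma tangentLift_comp {P Q : E → E} (hP : Differentiable ℝ P) (hQ : Differentiable ℝ Q) :
    tangentLift (P ∘ Q) = tangentLift P ∘ tangentLift Q := by
  funext p
  simp only [tangentLift, Function.comp_apply]
  rw [fderiv_comp _ (hP _) (hQ _)]
  rfl

lemma tangentLift_iterate {P : E → E} (hP : Differentiable ℝ P) (n : ℕ) :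
    tangentLift P^[n] = (tangentLift P)^[n] := by
  induction n with
  | zero =>
    funext p
    simp [tangentLift, fderiv_id]
  | succ n ih => rw [Function.iterate_succ, Function.iterate_succ, tangentLift_comp (hP.iterate n) hP,
      ih]

lemma IsGlobalFlow.tangent [FiniteDimensional ℝ E] {X : E → E} {φ : ℝ → E → E}
    (h : IsGlobalFlow X φ) (hX : TameField X) (hX2 : ContDiff ℝ 2 X) :
    IsGlobalFlow (tangentField X) fun t => tangentLift (φ t) := by
  refine fun p => ⟨?_, fun t => ?_⟩
  · have : φ 0 = id := funext h.zero
    simp [tangentLift, this, fderiv_id]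
  · refine (h.hasDerivAt p.1 t).prodMk ?_
    have := ((ContinuousLinearMap.compL ℝ E E E).flip p.2).hasFDerivAt.comp_hasDerivAt t
      (h.hasDerivAt_fderiv hX hX2 p.1 t)
    exact this

lemma contDiff_tangentField {X : E → E} (hX : ContDiff ℝ 2 X) :
    ContDiff ℝ 1 (tangentField X) :=
  ((hX.of_le (by norm_num)).comp contDiff_fst).prodMk
    (((hX.fderiv_right (m := 1) (by norm_num)).comp contDiff_fst).clm_comp contDiff_snd)

/-- The tangent lift of a field with linear growth and bounded derivative is tame. -/
lemma TameField.tangent {X : E → E} (hX : TameField X) (hX2 : ContDiff ℝ 2 X) {K : ℝ}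
    (hK : ∀ x, ‖fderiv ℝ X x‖ ≤ K) : TameField (tangentField X) := by
  obtain ⟨C, hC⟩ := hX.growth_pos
  refine ⟨contDiff_tangentField hX2, max C K, fun p => ?_⟩
  have hC0 : 0 ≤ max C K := hC.1.le.trans (le_max_left _ _)
  refine max_le ?_ ?_
  · refine (hC.2 p.1).trans ?_
    gcongr
    · exact le_max_left _ _
    · exact norm_fst_le p
  · refine (ContinuousLinearMap.opNorm_comp_le _ _).trans ?_
    refine mul_le_mul ((hK p.1).trans (le_max_right _ _)) ?_ (norm_nonneg _) hC0
    linarith [norm_snd_le p]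

lemma tangentField_add {X Y : E → E} (hX : Differentiable ℝ X) (hY : Differentiable ℝ Y) :
    tangentField (X + Y) = tangentField X + tangentField Y := by
  funext p
  simp [tangentField, fderiv_add (hX _) (hY _), ContinuousLinearMap.add_comp]

lemma hasFDerivAt_tangentField {X : E → E} (hX : ContDiff ℝ 2 X) (p : E × (E →L[ℝ] E)) :
    HasFDerivAt (tangentField X)
      (((fderiv ℝ X p.1).comp (.fst ℝ E (E →L[ℝ] E))).prod
        (((ContinuousLinearMap.compL ℝ E E E (fderiv ℝ X p.1)).comp (.snd ℝ E (E →L[ℝ] E))) +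
          ((ContinuousLinearMap.compL ℝ E E E).flip p.2).comp
            ((fderiv ℝ (fderiv ℝ X) p.1).comp (.fst ℝ E (E →L[ℝ] E))))) p := by
  have h1 : HasFDerivAt X (fderiv ℝ X p.1) p.1 := (hX.differentiable two_ne_zero p.1).hasFDerivAt
  have h2 : HasFDerivAt (fderiv ℝ X) (fderiv ℝ (fderiv ℝ X) p.1) p.1 :=
    ((hX.fderiv_right (m := 1) (by norm_num)).differentiable one_ne_zero p.1).hasFDerivAt
  exact (h1.comp p hasFDerivAt_fst).prodMk ((h2.comp p hasFDerivAt_fst).clm_comp hasFDerivAt_snd)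

/-- The tangent lift is a morphism of Lie algebras; this is the symmetry of second derivatives. -/
lemma lieBracket_tangentField {X Y : E → E} (hX : ContDiff ℝ 2 X) (hY : ContDiff ℝ 2 Y) :
    lieBracket ℝ (tangentField X) (tangentField Y) = tangentField (lieBracket ℝ X Y) := by
  funext p
  have hdX : HasFDerivAt X (fderiv ℝ X p.1) p.1 := (hX.differentiable two_ne_zero p.1).hasFDerivAt
  have hdY : HasFDerivAt Y (fderiv ℝ Y p.1) p.1 := (hY.differentiable two_ne_zero p.1).hasFDerivAt
  have hddX : HasFDerivAt (fderiv ℝ X) (fderiv ℝ (fderiv ℝ X) p.1) p.1 :=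
    ((hX.fderiv_right (m := 1) (by norm_num)).differentiable one_ne_zero p.1).hasFDerivAt
  have hddY : HasFDerivAt (fderiv ℝ Y) (fderiv ℝ (fderiv ℝ Y) p.1) p.1 :=
    ((hY.fderiv_right (m := 1) (by norm_num)).differentiable one_ne_zero p.1).hasFDerivAt
  have hbr : HasFDerivAt (lieBracket ℝ X Y) _ p.1 :=
    (hddY.clm_apply hdX).sub (hddX.clm_apply hdY)
  have sX : ∀ v w, fderiv ℝ (fderiv ℝ X) p.1 v w = fderiv ℝ (fderiv ℝ X) p.1 w v :=
    (hX.contDiffAt.isSymmSndFDerivAt (by simp))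
  have sY : ∀ v w, fderiv ℝ (fderiv ℝ Y) p.1 v w = fderiv ℝ (fderiv ℝ Y) p.1 w v :=
    (hY.contDiffAt.isSymmSndFDerivAt (by simp))
  rw [lieBracket, (hasFDerivAt_tangentField hX p).fderiv, (hasFDerivAt_tangentField hY p).fderiv]
  simp only [tangentField]
  rw [hbr.fderiv]
  refine Prod.ext rfl (ContinuousLinearMap.ext fun v => ?_)
  simp [sX (Y p.1), sY (X p.1)]

end TangentLift

section FlowLimits

open VectorField

variable {E : Type*} [NormedAddCommGroup E] [NormedSpace ℝ E] [FiniteDimensional ℝ E]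
  {F₁ F₂ : E → E} {φ ψ θ : ℝ → E → E}

/-- If the tangent lifts of the maps `S τ` agree to first order with the tangent lift of the flow
of `X`, then the iterates `S (1 / n)ⁿ` converge to the flow of `X` at time `1`, pointwise together
with their first derivatives. -/
lemma tendsto_iterate_and_fderiv {X : E → E} (hX : TameField X) (hX2 : ContDiff ℝ 2 X)
    (hθ : IsGlobalFlow X θ) {S : ℝ → E → E} (hSd : ∀ τ, Differentiable ℝ (S τ))
    (hS : ∀ x, ∀ c > 0, ∀ᶠ q : ℝ × (E × (E →L[ℝ] E)) in 𝓝 (0, x), 0 ≤ q.1 →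
      ‖tangentLift (S q.1) q.2 - q.2 - q.1 • tangentField X q.2‖ ≤ c * q.1) (x : E) :
    Tendsto (fun n : ℕ => (S (1 / n))^[n] x) atTop (𝓝 (θ 1 x)) ∧
      Tendsto (fun n : ℕ => fderiv ℝ (S (1 / n))^[n] x) atTop (𝓝 (fderiv ℝ (θ 1) x)) := by
  have hT := hθ.tangent hX hX2
  have key := tendsto_iterate_of_consistent (contDiff_tangentField hX2)
    (p := fun t => tangentLift (θ t) (x, .id ℝ E)) (fun t => hT.hasDerivAt (x, .id ℝ E) t)
    (S := fun τ => tangentLift (S τ)) hS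
  have h0 : tangentLift (θ 0) (x, .id ℝ E) = (x, .id ℝ E) := hT.zero _
  simp only [h0, ← tangentLift_iterate (hSd _)] at key
  have h1 := (continuous_fst.tendsto _).comp key
  have h2 := (continuous_snd.tendsto _).comp key
  exact ⟨h1, h2⟩

/-- **Lie-Trotter product formula** for flows, with convergence of the first derivatives. -/
lemma tendsto_trotter (h₁ : TameField F₁) (h₂ : TameField F₂) (s₁ : ContDiff ℝ 2 F₁)
    (s₂ : ContDiff ℝ 2 F₂) {K₁ K₂ : ℝ} (hK₁ : ∀ x, ‖fderiv ℝ F₁ x‖ ≤ K₁)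
    (hK₂ : ∀ x, ‖fderiv ℝ F₂ x‖ ≤ K₂) (hφ : IsGlobalFlow F₁ φ) (hψ : IsGlobalFlow F₂ ψ)
    (h : TameField (F₁ + F₂)) (hθ : IsGlobalFlow (F₁ + F₂) θ) (x : E) :
    Tendsto (fun n : ℕ => (ψ (1 / n) ∘ φ (1 / n))^[n] x) atTop (𝓝 (θ 1 x)) ∧
      Tendsto (fun n : ℕ => fderiv ℝ (ψ (1 / n) ∘ φ (1 / n))^[n] x) atTop
        (𝓝 (fderiv ℝ (θ 1) x)) := by
  have dφ := fun t => hφ.differentiable h₁ s₁ t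
  have dψ := fun t => hψ.differentiable h₂ s₂ t
  refine tendsto_iterate_and_fderiv h (s₁.add s₂) hθ (S := fun τ => ψ τ ∘ φ τ)
    (fun τ => (dψ τ).comp (dφ τ)) (fun p c hc => ?_) x
  have t₁ := h₁.tangent s₁ hK₁
  have t₂ := h₂.tangent s₂ hK₂
  have Tφ := hφ.tangent h₁ s₁
  have Tψ := hψ.tangent h₂ s₂
  have := isLittleO_flow_comp_one Tφ Tψ t₁.contDiff.continuous t₂.contDiff.continuous
    (Tφ.tendsto_zero t₁ p) (Tψ.tendsto_zero t₂ p)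
  rw [tangentField_add (s₁.differentiable two_ne_zero) (s₂.differentiable two_ne_zero)]
  filter_upwards [Asymptotics.isLittleO_iff.1 this hc] with q hq hq0
  rw [tangentLift_comp (dψ _) (dφ _)]
  simpa [abs_of_nonneg hq0] using hq

/-- The commutator product formula for flows, with convergence of the first derivatives. -/
lemma tendsto_commutator (h₁ : TameField F₁) (h₂ : TameField F₂) (s₁ : ContDiff ℝ 3 F₁)
    (s₂ : ContDiff ℝ 3 F₂) {K₁ K₂ : ℝ} (hK₁ : ∀ x, ‖fderiv ℝ F₁ x‖ ≤ K₁)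
    (hK₂ : ∀ x, ‖fderiv ℝ F₂ x‖ ≤ K₂) (hφ : IsGlobalFlow F₁ φ) (hψ : IsGlobalFlow F₂ ψ)
    (h : TameField (lieBracket ℝ F₁ F₂)) (hθ : IsGlobalFlow (lieBracket ℝ F₁ F₂) θ) (x : E) :
    Tendsto (fun n : ℕ => (ψ (-√(1 / n)) ∘ φ (-√(1 / n)) ∘ ψ √(1 / n) ∘ φ √(1 / n))^[n] x)
        atTop (𝓝 (θ 1 x)) ∧
      Tendsto (fun n : ℕ =>
          fderiv ℝ (ψ (-√(1 / n)) ∘ φ (-√(1 / n)) ∘ ψ √(1 / n) ∘ φ √(1 / n))^[n] x)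
        atTop (𝓝 (fderiv ℝ (θ 1) x)) := by
  have s₁' : ContDiff ℝ 2 F₁ := s₁.of_le (by norm_num)
  have s₂' : ContDiff ℝ 2 F₂ := s₂.of_le (by norm_num)
  have dφ := fun t => hφ.differentiable h₁ s₁' t
  have dψ := fun t => hψ.differentiable h₂ s₂' t
  have hbr2 : ContDiff ℝ 2 (lieBracket ℝ F₁ F₂) :=
    ((s₂.fderiv_right (m := 2) (by norm_num)).clm_apply s₁').sub
      ((s₁.fderiv_right (m := 2) (by norm_num)).clm_apply s₂')
  refine tendsto_iterate_and_fderiv h hbr2 hθ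
    (S := fun τ => ψ (-√τ) ∘ φ (-√τ) ∘ ψ √τ ∘ φ √τ)
    (fun τ => (dψ _).comp ((dφ _).comp ((dψ _).comp (dφ _)))) (fun p c hc => ?_) x
  have t₁ := h₁.tangent s₁' hK₁
  have t₂ := h₂.tangent s₂' hK₂
  have Tφ := hφ.tangent h₁ s₁'
  have Tψ := hψ.tangent h₂ s₂'
  have := isLittleO_flow_commutator Tφ Tψ t₁.contDiff t₂.contDiff
    (Tφ.tendsto_zero t₁ p) (Tψ.tendsto_zero t₂ p)
  rw [lieBracket_tangentField s₁' s₂'] at this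
  have hsq : Tendsto (fun q : ℝ × (E × (E →L[ℝ] E)) => (√q.1, q.2)) (𝓝 (0, p)) (𝓝 (0, p)) := by
    have : Continuous fun q : ℝ × (E × (E →L[ℝ] E)) => (√q.1, q.2) := by fun_prop
    simpa using this.tendsto (0, p)
  filter_upwards [hsq.eventually (Asymptotics.isLittleO_iff.1 this hc)] with q hq hq0
  rw [tangentLift_comp (dψ _) ((dφ _).comp ((dψ _).comp (dφ _))),
    tangentLift_comp (dφ _) ((dψ _).comp (dφ _)), tangentLift_comp (dψ _) (dφ _)]
  simpa [Real.sq_sqrt hq0, abs_of_nonneg hq0] using hq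

end FlowLimits

/-! ### Small-time reachable operators -/

section SmallTimeReachability

variable {d m : ℕ} {M : Type} [AddCommGroup M] [PseudoMetricSpace M] [MeasureSpace M]
  {e : Eucl d → M} {V : M → ℝ} {W : Fin m → M → ℝ}

/-- The evolution under a fixed control is the restriction of a unitary operator. -/
lemma Evolves.exists_unitary {u : PWControl m} {ψ₀ ψ₁ : LTwo M} (h : Evolves e V W u ψ₀ ψ₁) :
    ∃ U : LTwo M ≃ₗᵢ[ℂ] LTwo M, U ψ₀ = ψ₁ ∧ ∀ ψ, Evolves e V W u ψ (U ψ) := by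
  induction h with
  | nil ψ => exact ⟨.refl ℂ _, rfl, fun ψ => .nil ψ⟩
  | cons τ a u U ψ₀ ψ₁ hτ hU h ih =>
    obtain ⟨U', hU', hev⟩ := ih
    exact ⟨(U τ).trans U', hU', fun ψ => .cons τ a u U ψ _ hτ hU (hev (U τ ψ))⟩

lemma Evolves.append {u v : PWControl m} {ψ₀ ψ₁ ψ₂ : LTwo M} (h₁ : Evolves e V W u ψ₀ ψ₁)
    (h₂ : Evolves e V W v ψ₁ ψ₂) : Evolves e V W (u ++ v) ψ₀ ψ₂ := by
  induction h₁ with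
  | nil ψ => exact h₂
  | cons τ a u U ψ₀ ψ₁ hτ hU h ih => exact .cons τ a _ U _ _ hτ hU (ih h₂)

lemma PWControl.duration_append (u v : PWControl m) :
    PWControl.duration (u ++ v) = u.duration + v.duration := by
  simp [PWControl.duration]

lemma exists_mem_Ico_exp_eq (θ : ℝ) :
    ∃ θ' ∈ Set.Ico 0 (2 * π), Complex.exp (θ' * Complex.I) = Complex.exp (θ * Complex.I) := by
  refine ⟨toIcoMod two_pi_pos 0 θ, by simpa using toIcoMod_mem_Ico two_pi_pos 0 θ, ?_⟩
  rw [toIcoMod, Complex.exp_eq_exp_iff_exists_int]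
  refine ⟨-toIcoDiv two_pi_pos 0 θ, ?_⟩
  push_cast [zsmul_eq_mul]
  ring

lemma isSTAR_refl : IsSTAR e V W (.refl ℂ (LTwo M)) := fun ψ₀ _ ε hε =>
  ⟨0, ⟨le_rfl, hε.le⟩, 0, ⟨le_rfl, two_pi_pos⟩, [], by simp [PWControl.duration], ψ₀, .nil ψ₀,
    by simpa using hε⟩

/-- Running one after the other two controls that approximately realize `L` and `L'` approximately
realizes `L' ∘ L`, because the second evolution is an isometry. -/
lemma IsSTAR.trans {L L' : LTwo M ≃ₗᵢ[ℂ] LTwo M} (hL : IsSTAR e V W L) (hL' : IsSTAR e V W L') :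
    IsSTAR e V W (L.trans L') := by
  intro ψ₀ hψ₀ ε hε
  obtain ⟨T, hT, θ, -, u, hu, ψ₁, hev, herr⟩ := hL ψ₀ hψ₀ (ε / 2) (half_pos hε)
  obtain ⟨T', hT', θ', -, u', hu', ψ₂, hev', herr'⟩ :=
    hL' (L ψ₀) (by rw [L.norm_map, hψ₀]) (ε / 2) (half_pos hε)
  obtain ⟨U, rfl, hU⟩ := hev'.exists_unitary
  obtain ⟨θ'', hθ'', hexp⟩ := exists_mem_Ico_exp_eq (θ + θ')
  refine ⟨T + T', ⟨by linarith [hT.1, hT'.1], by linarith [hT.2, hT'.2]⟩, θ'', hθ'', u ++ u', ?_,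
    U ψ₁, hev.append (hU ψ₁), ?_⟩
  · rw [PWControl.duration_append, hu, hu']
  · have hsplit : U ψ₁ - Complex.exp (θ'' * Complex.I) • (L.trans L') ψ₀ =
        U (ψ₁ - Complex.exp (θ * Complex.I) • L ψ₀) + Complex.exp (θ * Complex.I) •
          (U (L ψ₀) - Complex.exp (θ' * Complex.I) • L' (L ψ₀)) := by
      rw [hexp, map_sub, map_smul, smul_sub, smul_smul, ← Complex.exp_add]
      push_cast
      rw [add_mul]
      simp
    rw [hsplit]
    refine (norm_add_le _ _).trans_lt ?_
    rw [U.norm_map, norm_smul, Complex.norm_exp_ofReal_mul_I, one_mul]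
    linarith

/-- Strong limits of `L²`-STAR operators are `L²`-STAR. -/
lemma IsSTAR.of_tendsto {L : LTwo M ≃ₗᵢ[ℂ] LTwo M} {L' : ℕ → LTwo M ≃ₗᵢ[ℂ] LTwo M}
    (hL' : ∀ n, IsSTAR e V W (L' n)) (h : ∀ ψ, Tendsto (fun n => L' n ψ) atTop (𝓝 (L ψ))) :
    IsSTAR e V W L := by
  intro ψ₀ hψ₀ ε hε
  obtain ⟨n, hn⟩ := ((Metric.tendsto_nhds.1 (h ψ₀)) (ε / 2) (half_pos hε)).exists
  obtain ⟨T, hT, θ, hθ, u, hu, ψ₁, hev, herr⟩ := hL' n ψ₀ hψ₀ (ε / 2) (half_pos hε)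
  refine ⟨T, ⟨hT.1, by linarith [hT.2]⟩, θ, hθ, u, hu, ψ₁, hev, ?_⟩
  have hsplit : ψ₁ - Complex.exp (θ * Complex.I) • L ψ₀ =
      (ψ₁ - Complex.exp (θ * Complex.I) • L' n ψ₀) +
        Complex.exp (θ * Complex.I) • (L' n ψ₀ - L ψ₀) := by
    rw [smul_sub]
    abel
  rw [hsplit]
  refine (norm_add_le _ _).trans_lt ?_
  rw [norm_smul, Complex.norm_exp_ofReal_mul_I, one_mul, ← dist_eq_norm (L' n ψ₀)]
  linarith

end SmallTimeReachability

/-! ### Quotients of `ℝᵈ` and changes of variables -/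

section Lifts

variable {d : ℕ} {M : Type} [AddCommGroup M]

/-- `p` is a diffeomorphism of `ℝᵈ` with inverse `q` that commutes with the translations by the
lattice of `e`, so that it induces a diffeomorphism of `M`. -/
structure IsCoverDiffeo (e : Eucl d → M) (p q : Eucl d → Eucl d) : Prop where
  differentiable : Differentiable ℝ p
  differentiable_inv : Differentiable ℝ q
  left_inv : ∀ x, q (p x) = x
  right_inv : ∀ x, p (q x) = x
  equivariant : ∀ x k, e k = 0 → p (x + k) = p x + k

variable {e : Eucl d → M} {p q : Eucl d → Eucl d}

lemma IsCoverDiffeo.symm (h : IsCoverDiffeo e p q) : IsCoverDiffeo e q p where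
  differentiable := h.differentiable_inv
  differentiable_inv := h.differentiable
  left_inv := h.right_inv
  right_inv := h.left_inv
  equivariant x k hk := by
    rw [← h.left_inv (q x + k), h.equivariant _ _ hk, h.right_inv]

lemma IsCoverDiffeo.quasiMeasurePreserving_lift (h : IsCoverDiffeo e p q) :
    Measure.QuasiMeasurePreserving p (volume : Measure (Eucl d)) volume := by
  have hmeas := h.differentiable.continuous.measurable
  refine ⟨hmeas, Measure.AbsolutelyContinuous.mk fun N hN h0 => ?_⟩
  rw [Measure.map_apply hmeas hN]
  have hpre : p ⁻¹' N = q '' N := by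
    ext x
    refine ⟨fun hx => ⟨p x, hx, h.left_inv x⟩, ?_⟩
    rintro ⟨z, hz, rfl⟩
    rwa [Set.mem_preimage, h.right_inv]
  rw [hpre]
  exact addHaar_image_eq_zero_of_differentiableOn_of_addHaar_eq_zero _
    h.differentiable_inv.differentiableOn h0

lemma HasDiffAt.comp {P Q : M → M} {A B : Eucl d →L[ℝ] Eucl d} {y : M} (hQ : HasDiffAt e Q B (P y))
    (hP : HasDiffAt e P A y) : HasDiffAt e (Q ∘ P) (B.comp A) y := by
  obtain ⟨w, hw0, hwA, hw⟩ := hP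
  obtain ⟨w', hw'0, hwB, hw'⟩ := hQ
  refine ⟨w' ∘ w, by simp [hw0, hw'0], ?_, ?_⟩
  · refine HasFDerivAt.comp 0 ?_ hwA
    rwa [hw0]
  · have ht : Tendsto w (𝓝 0) (𝓝 0) := by simpa [hw0] using hwA.continuousAt.tendsto
    filter_upwards [hw, ht.eventually hw'] with v h1 h2
    simp only [Function.comp_apply, h1, h2]

end Lifts

section FlatCover

open scoped ENNReal

variable {d : ℕ} {M : Type} [AddCommGroup M] [PseudoMetricSpace M] [MeasureSpace M]

/-- The exponential map `e : ℝᵈ → M` presents `M` as the quotient of `ℝᵈ` by a discrete subgroup,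
and `s` is a measurable section of `e` whose range is a fundamental domain. -/
structure IsFlatCover (e : Eucl d → M) (s : M → Eucl d) : Prop where
  map_add : ∀ x y, e (x + y) = e x + e y
  lipschitz : LipschitzWith 1 e
  eventually_eq_zero : ∀ᶠ v in 𝓝 (0 : Eucl d), e v = 0 → v = 0
  countable_ker : {k | e k = 0}.Countable
  measurable_section : Measurable s
  apply_section : ∀ y, e (s y) = y
  measurableSet_range : MeasurableSet (Set.range s)
  measurePreserving : MeasurePreserving e (volume.restrict (Set.range s)) volume

namespace IsFlatCover

variable {e : Eucl d → M} {s : M → Eucl d}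

lemma map_zero (he : IsFlatCover e s) : e 0 = 0 := by
  simpa using he.map_add 0 0

lemma map_sub (he : IsFlatCover e s) (x y : Eucl d) : e (x - y) = e x - e y := by
  rw [eq_sub_iff_add_eq, ← he.map_add, sub_add_cancel]

lemma section_apply (he : IsFlatCover e s) {x : Eucl d} (hx : x ∈ Set.range s) : s (e x) = x := by
  obtain ⟨y, rfl⟩ := hx
  rw [he.apply_section]

/-- The lattice by which `e` is the quotient map. -/
def ker (he : IsFlatCover e s) : AddSubgroup (Eucl d) where
  carrier := {k | e k = 0}
  add_mem' {a b} ha hb := by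
    change e (a + b) = 0
    rw [he.map_add, show e a = 0 from ha, show e b = 0 from hb, add_zero]
  zero_mem' := he.map_zero
  neg_mem' {a} ha := by
    change e (-a) = 0
    rw [← zero_sub, he.map_sub, he.map_zero, show e a = 0 from ha, sub_zero]

lemma isAddFundamentalDomain (he : IsFlatCover e s) :
    IsAddFundamentalDomain he.ker (Set.range s) (volume : Measure (Eucl d)) := by
  refine .mk' he.measurableSet_range.nullMeasurableSet fun x => ?_
  refine ⟨⟨s (e x) - x, ?_⟩, ⟨e x, ?_⟩, ?_⟩
  · change e (s (e x) - x) = 0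
    rw [he.map_sub, he.apply_section, sub_self]
  · change s (e x) = s (e x) - x + x
    rw [sub_add_cancel]
  · rintro ⟨k, hk⟩ hkx
    have h1 : k + x ∈ Set.range s := hkx
    have h2 : e (k + x) = e x := by rw [he.map_add, show e k = 0 from hk, zero_add]
    have h3 := he.section_apply h1
    rw [h2] at h3
    have h4 : k = s (e x) - x := by rw [h3, add_sub_cancel_right]
    exact Subtype.ext h4

lemma countable (he : IsFlatCover e s) : Countable he.ker := he.countable_ker.to_subtype

lemma lintegral_eq (he : IsFlatCover e s) {F : M → ℝ≥0∞} (hF : Measurable F) :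
    ∫⁻ y, F y = ∫⁻ x in Set.range s, F (e x) := by
  rw [← he.measurePreserving.map_eq, lintegral_map hF he.measurePreserving.measurable]

/-- The preimage in `ℝᵈ` of a null set of `M` is a null set. -/
lemma volume_preimage_eq_zero (he : IsFlatCover e s) {N : Set M} (hN : MeasurableSet N)
    (h0 : volume N = 0) : volume (e ⁻¹' N) = 0 := by
  have := he.countable
  refine he.isAddFundamentalDomain.measure_zero_of_invariant _ (fun g => ?_) ?_
  · ext x
    rw [Set.mem_vadd_set_iff_neg_vadd_mem]
    have hg : e (-(g : Eucl d)) = 0 := (-g).2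
    change e (-(g : Eucl d) + x) ∈ N ↔ e x ∈ N
    rw [he.map_add, hg, zero_add]
  · rw [← Measure.restrict_apply (he.measurePreserving.measurable hN),
      he.measurePreserving.measure_preimage hN.nullMeasurableSet, h0]

end IsFlatCover

section Descent

variable {e : Eucl d → M} {s : M → Eucl d} {p q : Eucl d → Eucl d} {P : M → M}

/-- If `P` lifts to `p`, the differentials of `P` are those of `p`. -/
lemma hasDiffAt_of_lift (he : IsFlatCover e s) (hP : ∀ x, P (e x) = e (p x))
    {A : Eucl d →L[ℝ] Eucl d} {x : Eucl d} (hA : HasFDerivAt p A x) : HasDiffAt e P A (e x) := by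
  refine ⟨fun v => p (x + v) - p x, by simp, ?_, Eventually.of_forall fun v => ?_⟩
  · have h1 : HasFDerivAt (fun v => p (x + v)) A 0 :=
      (hasFDerivAt_comp_add_left x).2 (by simpa using hA)
    exact h1.sub_const _
  · rw [← he.map_add, hP, hP, ← he.map_add, add_sub_cancel]

/-- The differential is unique because `e` is injective near `0`. -/
lemma HasDiffAt.unique (he : IsFlatCover e s) {A B : Eucl d →L[ℝ] Eucl d} {y : M}
    (hA : HasDiffAt e P A y) (hB : HasDiffAt e P B y) : A = B := by
  obtain ⟨w, hw0, hwA, hw⟩ := hA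
  obtain ⟨w', hw'0, hwB, hw'⟩ := hB
  have ht : Tendsto (fun v => w v - w' v) (𝓝 0) (𝓝 0) := by
    have := (hwA.fun_sub hwB).continuousAt.tendsto
    simpa [hw0, hw'0] using this
  have hev : w =ᶠ[𝓝 0] w' := by
    filter_upwards [hw, hw', ht.eventually he.eventually_eq_zero] with v h1 h2 h3
    refine sub_eq_zero.1 (h3 ?_)
    rw [he.map_sub, sub_eq_zero]
    exact add_left_cancel (h1.symm.trans h2)
  exact hwA.unique (hwB.congr_of_eventuallyEq hev)

lemma measurable_of_lift (he : IsFlatCover e s) (hp : Measurable p)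
    (hP : ∀ x, P (e x) = e (p x)) : Measurable P := by
  have : P = e ∘ p ∘ s := funext fun y => by
    rw [Function.comp_apply, Function.comp_apply, ← hP, he.apply_section]
  rw [this]
  exact he.measurePreserving.measurable.comp (hp.comp he.measurable_section)

lemma IsCoverDiffeo.quasiMeasurePreserving (h : IsCoverDiffeo e p q) (he : IsFlatCover e s)
    (hP : ∀ x, P (e x) = e (p x)) :
    Measure.QuasiMeasurePreserving P (volume : Measure M) volume := by
  have hmeas := measurable_of_lift he h.differentiable.continuous.measurable hP
  refine ⟨hmeas, Measure.AbsolutelyContinuous.mk fun N hN h0 => ?_⟩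
  rw [Measure.map_apply hmeas hN,
    ← he.measurePreserving.measure_preimage (hmeas hN).nullMeasurableSet]
  refine le_antisymm ((Measure.restrict_apply_le _ _).trans_eq ?_) zero_le
  have hpre : e ⁻¹' (P ⁻¹' N) = p ⁻¹' (e ⁻¹' N) := by
    ext x
    simp only [Set.mem_preimage, hP]
  rw [hpre]
  exact h.quasiMeasurePreserving_lift.preimage_null (he.volume_preimage_eq_zero hN h0)

/-- Change of variables on `M`: the lift maps one fundamental domain onto another one. -/
lemma IsCoverDiffeo.lintegral_comp (h : IsCoverDiffeo e p q) (he : IsFlatCover e s)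
    (hP : ∀ x, P (e x) = e (p x)) {F : M → ℝ≥0∞} (hF : Measurable F) :
    ∫⁻ y, ENNReal.ofReal |(fderiv ℝ p (s y)).det| * F (P y) = ∫⁻ y, F y := by
  have := he.countable
  have hdet : Measurable fun y => ENNReal.ofReal |(fderiv ℝ p (s y)).det| :=
    ENNReal.measurable_ofReal.comp (continuous_abs.measurable.comp
      (ContinuousLinearMap.continuous_det.measurable.comp
        ((measurable_fderiv ℝ p).comp he.measurable_section)))
  have hPm := measurable_of_lift he h.differentiable.continuous.measurable hP
  have hm : Measurable fun y => ENNReal.ofReal |(fderiv ℝ p (s y)).det| * F (P y) :=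
    hdet.mul (hF.comp hPm)
  rw [he.lintegral_eq hm, he.lintegral_eq hF]
  have h1 : ∫⁻ x in Set.range s, ENNReal.ofReal |(fderiv ℝ p (s (e x))).det| * F (P (e x)) =
      ∫⁻ x in Set.range s, ENNReal.ofReal |(fderiv ℝ p x).det| * F (e (p x)) :=
    setLIntegral_congr_fun he.measurableSet_range fun x hx => by
      simp only [he.section_apply hx, hP]
  have hinj : Function.Injective p := Function.LeftInverse.injective h.left_inv
  refine h1.trans ?_
  rw [← lintegral_image_eq_lintegral_abs_det_fderiv_mul volume he.measurableSet_range
    (fun x _ => (h.differentiable x).hasFDerivAt.hasFDerivWithinAt) hinj.injOn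
    fun x => F (e x)]
  have hdom : IsAddFundamentalDomain he.ker (p '' Set.range s) (volume : Measure (Eucl d)) :=
    he.isAddFundamentalDomain.image_of_equiv ⟨p, q, h.left_inv, h.right_inv⟩
      h.symm.quasiMeasurePreserving_lift (Equiv.refl _) fun k x => by
        change p ((k : Eucl d) + x) = (k : Eucl d) + p x
        rw [add_comm, h.equivariant x k k.2, add_comm]
  refine hdom.setLIntegral_eq he.isAddFundamentalDomain _ fun k x => ?_
  change F (e ((k : Eucl d) + x)) = _
  rw [he.map_add, show e (k : Eucl d) = 0 from k.2, zero_add]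

end Descent

end FlatCover

/-! ### The unitary action on `L²` and its continuity -/

section TransportOperators

open scoped ENNReal

section

variable {M : Type} [MeasureSpace M]

/-- Pointwise convergence together with convergence of the norms gives convergence in `L²`. The
parallelogram identity turns the claim into a lower bound for `‖f n + g‖`, which is Fatou's
lemma. -/
lemma tendsto_Lp_of_tendsto_ae_of_norm_eq {f : ℕ → LTwo M} {g : LTwo M}
    (hnorm : ∀ n, ‖f n‖ = ‖g‖) (h : ∀ᵐ y, Tendsto (fun n => f n y) atTop (𝓝 (g y))) :
    Tendsto f atTop (𝓝 g) := by
  have hfatou : ENNReal.ofReal ‖g + g‖ ≤ liminf (fun n => ENNReal.ofReal ‖f n + g‖) atTop := by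
    have := Lp.eLpNorm_lim_le_liminf_eLpNorm (μ := (volume : Measure M)) (p := 2)
      (f := fun n => ⇑(f n + g)) (fun n => Lp.aestronglyMeasurable _) (⇑(g + g)) (by
        filter_upwards [h, ae_all_iff.2 fun n => Lp.coeFn_add (f n) g, Lp.coeFn_add g g]
          with y h1 h2 h3
        simp only [h2, h3, Pi.add_apply]
        exact h1.add_const _)
    simpa only [Lp.norm_def, ENNReal.ofReal_toReal (Lp.eLpNorm_ne_top _)] using this
  rw [tendsto_iff_norm_sub_tendsto_zero, Metric.tendsto_atTop]
  intro ε hε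
  have h2g : ‖g + g‖ = 2 * ‖g‖ := by rw [← two_smul ℝ g, norm_smul]; norm_num
  have hpar : ∀ n, ‖f n - g‖ * ‖f n - g‖ = 4 * (‖g‖ * ‖g‖) - ‖f n + g‖ * ‖f n + g‖ := fun n => by
    have := parallelogram_law_with_norm ℂ (f n) g
    rw [hnorm] at this
    linarith
  rcases eq_or_lt_of_le (norm_nonneg g) with hg | hg
  · refine ⟨0, fun n _ => ?_⟩
    have h0 : g = 0 := norm_eq_zero.1 hg.symm
    have h1 : f n = 0 := norm_eq_zero.1 ((hnorm n).trans hg.symm)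
    simpa [h0, h1] using hε
  · -- a number `c < 2 ‖g‖` with `4 ‖g‖² - c² < ε²`
    obtain ⟨c, hc0, hc2, hcε⟩ : ∃ c : ℝ, 0 < c ∧ c < 2 * ‖g‖ ∧ 4 * (‖g‖ * ‖g‖) - c * c < ε * ε := by
      have hcont : Tendsto (fun c : ℝ => 4 * (‖g‖ * ‖g‖) - c * c) (𝓝[<] (2 * ‖g‖))
          (𝓝 (4 * (‖g‖ * ‖g‖) - 2 * ‖g‖ * (2 * ‖g‖))) := by
        have : Continuous fun c : ℝ => 4 * (‖g‖ * ‖g‖) - c * c := by fun_prop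
        exact (this.tendsto _).mono_left nhdsWithin_le_nhds
      have hlt : 4 * (‖g‖ * ‖g‖) - 2 * ‖g‖ * (2 * ‖g‖) < ε * ε := by nlinarith
      have hpos : ∀ᶠ c in 𝓝[<] (2 * ‖g‖), (0 : ℝ) < c :=
        nhdsWithin_le_nhds (lt_mem_nhds (by linarith))
      obtain ⟨c, h1, h2, h3⟩ :=
        ((hcont.eventually_lt_const hlt).and (hpos.and self_mem_nhdsWithin)).exists
      exact ⟨c, h2, h3, h1⟩
    have hev := eventually_lt_of_lt_liminf (lt_of_lt_of_le
      ((ENNReal.ofReal_lt_ofReal_iff (hc0.trans (hc2.trans_eq h2g.symm))).2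
        (hc2.trans_eq h2g.symm)) hfatou)
    obtain ⟨N, hN⟩ := eventually_atTop.1 hev
    refine ⟨N, fun n hn => ?_⟩
    have h1 : c < ‖f n + g‖ := (ENNReal.ofReal_lt_ofReal_iff_of_nonneg hc0.le).1 (hN n hn)
    rw [dist_zero_right, norm_norm]
    have h2 := hpar n
    by_contra! hcon
    nlinarith [norm_nonneg (f n - g)]

end

section

variable {d : ℕ} {M : Type} [AddCommGroup M] [MeasureSpace M] {e : Eucl d → M} {P Q : M → M}

lemma IsTransport.trans {L L' : LTwo M ≃ₗᵢ[ℂ] LTwo M}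
    (hP : Measure.QuasiMeasurePreserving P (volume : Measure M) volume)
    (hL : IsTransport e P L) (hL' : IsTransport e Q L') :
    IsTransport e (Q ∘ P) (L'.trans L) := by
  obtain ⟨A, hA, hLA⟩ := hL
  obtain ⟨B, hB, hLB⟩ := hL'
  refine ⟨fun y => (B (P y)).comp (A y), fun y => (hB (P y)).comp (hA y), fun ψ => ?_⟩
  filter_upwards [hLA (L' ψ), hP.ae (hLB ψ)] with y h1 h2
  have hdet : ((B (P y)).comp (A y)).det = (A y).det * (B (P y)).det := by
    simp [ContinuousLinearMap.det, mul_comm]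
  rw [LinearIsometryEquiv.trans_apply, h1, h2, hdet, abs_mul, Real.sqrt_mul (abs_nonneg _),
    Complex.ofReal_mul, mul_assoc]
  rfl

lemma isTransport_id : IsTransport e id (.refl ℂ (LTwo M)) :=
  ⟨fun _ => .id ℝ _, fun y => ⟨id, rfl, hasFDerivAt_id 0, Eventually.of_forall fun _ => rfl⟩,
    fun ψ => Eventually.of_forall fun y => by simp [ContinuousLinearMap.det]⟩

end

variable {d : ℕ} {M : Type} [AddCommGroup M] [PseudoMetricSpace M] [MeasureSpace M]
  {e : Eucl d → M} {s : M → Eucl d} {p q : Eucl d → Eucl d} {P : M → M}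

/-- The action `ψ ↦ |J_P|^{1/2} (ψ ∘ P)` preserves the `L²` norm, by the change of variables
formula. It is well defined on classes of functions as `P` preserves null sets. -/
lemma IsCoverDiffeo.exists_linearIsometry (h : IsCoverDiffeo e p q) (he : IsFlatCover e s)
    (hP : ∀ x, P (e x) = e (p x)) :
    ∃ T : LTwo M →ₗᵢ[ℂ] LTwo M, ∀ ψ : LTwo M,
      T ψ =ᵐ[volume] fun y => (√|(fderiv ℝ p (s y)).det| : ℂ) * ψ (P y) := by
  have hqmp := h.quasiMeasurePreserving he hP
  have hJ : Measurable fun y => ((√|(fderiv ℝ p (s y)).det| : ℝ) : ℂ) :=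
    Complex.measurable_ofReal.comp (Real.continuous_sqrt.measurable.comp
      (continuous_abs.measurable.comp (ContinuousLinearMap.continuous_det.measurable.comp
        ((measurable_fderiv ℝ p).comp he.measurable_section))))
  have hmeas : ∀ ψ : LTwo M, AEStronglyMeasurable
      (fun y => (√|(fderiv ℝ p (s y)).det| : ℂ) * ψ (P y)) volume := fun ψ =>
    hJ.aestronglyMeasurable.mul ((Lp.aestronglyMeasurable ψ).comp_quasiMeasurePreserving hqmp)
  have hnorm : ∀ ψ : LTwo M, eLpNorm (fun y => (√|(fderiv ℝ p (s y)).det| : ℂ) * ψ (P y)) 2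
      volume = eLpNorm ψ 2 volume := by
    intro ψ
    rw [eLpNorm_eq_lintegral_rpow_enorm_toReal two_ne_zero ENNReal.ofNat_ne_top,
      eLpNorm_eq_lintegral_rpow_enorm_toReal two_ne_zero ENNReal.ofNat_ne_top]
    congr 1
    rw [← h.lintegral_comp he hP (F := fun y => ‖ψ y‖ₑ ^ (2 : ℝ≥0∞).toReal)
      ((Lp.stronglyMeasurable ψ).measurable.enorm.pow_const _)]
    refine lintegral_congr fun y => ?_
    rw [enorm_mul, ENNReal.mul_rpow_of_nonneg _ _ (by simp)]
    congr 1
    rw [← ofReal_norm, Complex.norm_real, Real.norm_eq_abs, abs_of_nonneg (sqrt_nonneg _),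
      ENNReal.toReal_ofNat, ENNReal.rpow_ofNat, ← ENNReal.ofReal_pow (sqrt_nonneg _),
      Real.sq_sqrt (abs_nonneg _)]
  have hLp : ∀ ψ : LTwo M, MemLp (fun y => (√|(fderiv ℝ p (s y)).det| : ℂ) * ψ (P y)) 2 volume :=
    fun ψ => ⟨hmeas ψ, by rw [hnorm]; exact (Lp.memLp ψ).2⟩
  refine ⟨⟨⟨⟨fun ψ => (hLp ψ).toLp _, fun ψ χ => ?_⟩, fun c ψ => ?_⟩, fun ψ => ?_⟩,
    fun ψ => (hLp ψ).coeFn_toLp⟩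
  · refine Lp.ext ?_
    filter_upwards [(hLp (ψ + χ)).coeFn_toLp, (hLp ψ).coeFn_toLp, (hLp χ).coeFn_toLp,
      Lp.coeFn_add ((hLp ψ).toLp _) ((hLp χ).toLp _), hqmp.ae (Lp.coeFn_add ψ χ)]
      with y h1 h2 h3 h4 h5
    rw [h1, h4, Pi.add_apply, h2, h3, h5, Pi.add_apply, mul_add]
  · refine Lp.ext ?_
    filter_upwards [(hLp (c • ψ)).coeFn_toLp, (hLp ψ).coeFn_toLp,
      Lp.coeFn_smul c ((hLp ψ).toLp _), hqmp.ae (Lp.coeFn_smul c ψ)] with y h1 h2 h3 h4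
    simp only [RingHom.id_apply]
    rw [h1, h3, Pi.smul_apply, h2, h4, Pi.smul_apply, smul_eq_mul, smul_eq_mul]
    ring
  · change ‖(hLp ψ).toLp _‖ = ‖ψ‖
    rw [Lp.norm_toLp, hnorm, Lp.norm_def]

lemma IsCoverDiffeo.lift_descend (h : IsCoverDiffeo e p q) (he : IsFlatCover e s) (x : Eucl d) :
    e (p (s (e x))) = e (p x) := by
  have hk : e (s (e x) - x) = 0 := by rw [he.map_sub, he.apply_section, sub_self]
  have := h.equivariant x _ hk
  rw [add_sub_cancel] at this
  rw [this, he.map_add, hk, add_zero]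

/-- The diffeomorphism of `M` induced by `p` acts on `L²(M)` by a unitary operator, whose inverse is
the operator of the inverse diffeomorphism. -/
lemma IsCoverDiffeo.exists_isTransport (h : IsCoverDiffeo e p q) (he : IsFlatCover e s)
    (hP : ∀ x, P (e x) = e (p x)) : ∃ L, IsTransport e P L := by
  obtain ⟨P', hP'⟩ : ∃ P' : M → M, ∀ x, P' (e x) = e (q x) :=
    ⟨fun y => e (q (s y)), h.symm.lift_descend he⟩
  have hqmp := h.quasiMeasurePreserving he hP
  obtain ⟨T, hT⟩ := h.exists_linearIsometry he hP
  obtain ⟨T', hT'⟩ := h.symm.exists_linearIsometry he hP'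
  have hsurj : Function.Surjective T := fun ψ => by
    refine ⟨T' ψ, Lp.ext ?_⟩
    filter_upwards [hT (T' ψ), hqmp.ae (hT' ψ)] with y h1 h2
    have hy : P y = e (p (s y)) := by rw [← hP, he.apply_section]
    -- `s (P y)` and `p (s y)` may differ by an element of the lattice
    have hdet : fderiv ℝ q (s (P y)) = fderiv ℝ q (p (s y)) := by
      have d1 := hasDiffAt_of_lift he hP' (h.differentiable_inv (s (P y))).hasFDerivAt
      have d2 := hasDiffAt_of_lift he hP' (h.differentiable_inv (p (s y))).hasFDerivAt
      rw [he.apply_section] at d1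
      rw [← hy] at d2
      exact d1.unique he d2
    have hcomp : (fderiv ℝ q (p (s y))).comp (fderiv ℝ p (s y)) = .id ℝ (Eucl d) := by
      rw [← fderiv_comp _ (h.differentiable_inv _) (h.differentiable _)]
      have : q ∘ p = id := funext h.left_inv
      rw [this, fderiv_id]
    have hone : (fderiv ℝ p (s y)).det * (fderiv ℝ q (p (s y))).det = 1 := by
      rw [mul_comm]
      have := congrArg ContinuousLinearMap.det hcomp
      simpa [ContinuousLinearMap.det] using this
    have hQP : P' (P y) = y := by rw [hy, hP', h.left_inv, he.apply_section]
    rw [h1, h2, hQP, hdet, ← mul_assoc, ← Complex.ofReal_mul, ← Real.sqrt_mul (abs_nonneg _),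
      ← abs_mul, hone, abs_one, Real.sqrt_one, Complex.ofReal_one, one_mul]
  refine ⟨LinearIsometryEquiv.ofSurjective T hsurj, fun y => fderiv ℝ p (s y), fun y => ?_, hT⟩
  have := hasDiffAt_of_lift he hP (h.differentiable (s y)).hasFDerivAt
  rwa [he.apply_section] at this

/-- If diffeomorphisms converge pointwise together with their first derivatives, then their actions
on `L²(M)` converge strongly. -/
lemma tendsto_transport [BorelSpace M] [(volume : Measure M).WeaklyRegular]
    (he : IsFlatCover e s) {pₙ : ℕ → Eucl d → Eucl d} {Pₙ : ℕ → M → M}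
    {Lₙ : ℕ → LTwo M ≃ₗᵢ[ℂ] LTwo M} {L : LTwo M ≃ₗᵢ[ℂ] LTwo M}
    (hlift : ∀ n x, Pₙ n (e x) = e (pₙ n x)) (hP : ∀ x, P (e x) = e (p x))
    (hdiff : ∀ n, Differentiable ℝ (pₙ n)) (hp : Differentiable ℝ p)
    (hqmpₙ : ∀ n, Measure.QuasiMeasurePreserving (Pₙ n) (volume : Measure M) volume)
    (hqmp : Measure.QuasiMeasurePreserving P (volume : Measure M) volume)
    (hLₙ : ∀ n, IsTransport e (Pₙ n) (Lₙ n)) (hL : IsTransport e P L)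
    (hconv : ∀ x, Tendsto (fun n => pₙ n x) atTop (𝓝 (p x)))
    (hdconv : ∀ x, Tendsto (fun n => fderiv ℝ (pₙ n) x) atTop (𝓝 (fderiv ℝ p x)))
    (ψ : LTwo M) : Tendsto (fun n => Lₙ n ψ) atTop (𝓝 (L ψ)) := by
  have hcoe : ∀ {p : Eucl d → Eucl d} {P : M → M} {L : LTwo M ≃ₗᵢ[ℂ] LTwo M},
      (∀ x, P (e x) = e (p x)) → Differentiable ℝ p →
      Measure.QuasiMeasurePreserving P (volume : Measure M) volume → IsTransport e P L →
      ∀ (χ : LTwo M) (g : M → ℂ), χ =ᵐ[volume] g →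
        ∀ᵐ y, L χ y = (√|(fderiv ℝ p (s y)).det| : ℂ) * g (e (p (s y))) := by
    intro p P L hP hp hqmp ⟨A, hA, hLA⟩ χ g hχ
    filter_upwards [hLA χ, hqmp.ae hχ] with y h1 h2
    have h3 := hasDiffAt_of_lift he hP (hp (s y)).hasFDerivAt
    rw [he.apply_section] at h3
    rw [h1, h2, (hA y).unique he h3, ← hP, he.apply_section]
  -- convergence on bounded continuous functions
  have hdense : ∀ χ ∈ Lp.boundedContinuousFunction ℂ 2 (volume : Measure M),
      Tendsto (fun n => Lₙ n χ) atTop (𝓝 (L χ)) := by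
    intro χ hχ
    obtain ⟨g, hg⟩ := Lp.mem_boundedContinuousFunction_iff.1 hχ
    have hχg : χ =ᵐ[volume] g := by
      have := ContinuousMap.coeFn_toAEEqFun (volume : Measure M) g.toContinuousMap
      rw [hg] at this
      exact this
    refine tendsto_Lp_of_tendsto_ae_of_norm_eq (fun n => by simp) ?_
    filter_upwards [ae_all_iff.2 fun n => hcoe (hlift n) (hdiff n) (hqmpₙ n) (hLₙ n) χ g hχg,
      hcoe hP hp hqmp hL χ g hχg] with y h1 h2
    simp only [h1, h2]
    have hsq : Continuous fun A : Eucl d →L[ℝ] Eucl d => ((√|A.det| : ℝ) : ℂ) :=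
      Complex.continuous_ofReal.comp (Real.continuous_sqrt.comp
        (continuous_abs.comp ContinuousLinearMap.continuous_det))
    exact ((hsq.tendsto _).comp (hdconv (s y))).mul
      (((g.continuous.comp he.lipschitz.continuous).tendsto _).comp (hconv (s y)))
  rw [Metric.tendsto_atTop]
  intro ε hε
  obtain ⟨χ, hχ, hχψ⟩ := Metric.dense_iff.1
    (Lp.boundedContinuousFunction_dense ℂ (volume : Measure M) (p := 2) ENNReal.ofNat_ne_top)
    ψ (ε / 3) (by positivity)
  obtain ⟨N, hN⟩ := Metric.tendsto_atTop.1 (hdense χ hχψ) (ε / 3) (by positivity)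
  refine ⟨N, fun n hn => ?_⟩
  have hχd : dist χ ψ < ε / 3 := hχ
  calc dist (Lₙ n ψ) (L ψ) ≤ dist (Lₙ n ψ) (Lₙ n χ) + dist (Lₙ n χ) (L χ) + dist (L χ) (L ψ) :=
        dist_triangle4 _ _ _ _
    _ < ε := by
      rw [LinearIsometryEquiv.dist_map, LinearIsometryEquiv.dist_map, dist_comm ψ]
      linarith [hN n hn]

end TransportOperators

/-! ### Vector fields on `M` and their lifts -/

section STARFields

open VectorField
open scoped NNReal

section

variable {d : ℕ} {M : Type} [AddCommGroup M] {e : Eucl d → M}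

lemma IsSmooth.contDiff_comp {G : Type} [NormedAddCommGroup G] [NormedSpace ℝ G] {F : M → G}
    (hF : IsSmooth e F) : ContDiff ℝ ∞ (F ∘ e) := by
  simpa [Function.comp_def] using hF 0

variable [PseudoMetricSpace M] {f g : M → Eucl d}

lemma add_mem_lipVec (hf : f ∈ LipVec e) (hg : g ∈ LipVec e) : f + g ∈ LipVec e := by
  obtain ⟨K, hK⟩ := hf.2
  obtain ⟨K', hK'⟩ := hg.2
  exact ⟨fun y => (hf.1 y).add (hg.1 y), K + K', hK.add hK'⟩

lemma smul_mem_lipVec (c : ℝ) (hf : f ∈ LipVec e) : c • f ∈ LipVec e := by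
  obtain ⟨K, hK⟩ := hf.2
  exact ⟨fun y => contDiff_const.smul (hf.1 y), _, (lipschitzWith_smul c).comp hK⟩

end

variable {d m : ℕ} {M : Type} [AddCommGroup M] [PseudoMetricSpace M] [MeasureSpace M]
  {e : Eucl d → M} {s : M → Eucl d} {V : M → ℝ} {W : Fin m → M → ℝ} {f g : M → Eucl d}

lemma IsFlatCover.isSmooth {G : Type} [NormedAddCommGroup G] [NormedSpace ℝ G] {F : M → G}
    (he : IsFlatCover e s) (hF : ContDiff ℝ ∞ (F ∘ e)) : IsSmooth e F := by
  intro y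
  have : (fun v => F (y + e v)) = fun v => (F ∘ e) (s y + v) := funext fun v => by
    rw [Function.comp_apply, he.map_add, he.apply_section]
  rw [this]
  exact hF.comp (contDiff_const.add contDiff_id)

lemma IsFlatCover.fderiv_chart {G : Type} [NormedAddCommGroup G] [NormedSpace ℝ G]
    (he : IsFlatCover e s) (F : M → G) (x : Eucl d) :
    fderiv ℝ (fun v => F (e x + e v)) 0 = fderiv ℝ (F ∘ e) x := by
  have : (fun v => F (e x + e v)) = fun v => (F ∘ e) (x + v) := funext fun v => by
    rw [Function.comp_apply, he.map_add]
  rw [this, fderiv_comp_add_left, add_zero]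

lemma IsFlatCover.bracket_comp (he : IsFlatCover e s) (f g : M → Eucl d) :
    bracket e f g ∘ e = lieBracket ℝ (f ∘ e) (g ∘ e) := by
  funext x
  simp only [bracket, lieBracket, Function.comp_apply, he.fderiv_chart]

lemma exists_lipschitzWith_comp (he : IsFlatCover e s) (hf : f ∈ LipVec e) :
    ∃ K, LipschitzWith K (f ∘ e) := by
  obtain ⟨K, hK⟩ := hf.2
  exact ⟨K * 1, hK.comp he.lipschitz⟩

lemma exists_norm_fderiv_le (he : IsFlatCover e s) (hf : f ∈ LipVec e) :
    ∃ K : ℝ, ∀ x, ‖fderiv ℝ (f ∘ e) x‖ ≤ K := by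
  obtain ⟨K, hK⟩ := exists_lipschitzWith_comp he hf
  exact ⟨K, fun x => norm_fderiv_le_of_lipschitz ℝ hK⟩

lemma LipschitzWith.exists_linear_growth {E F : Type*} [NormedAddCommGroup E]
    [NormedAddCommGroup F] {X : E → F} {K : ℝ≥0} (hX : LipschitzWith K X) :
    ∃ C, 0 ≤ C ∧ ∀ x, ‖X x‖ ≤ C * (1 + ‖x‖) := by
  refine ⟨K + ‖X 0‖, by positivity, fun x => ?_⟩
  have h1 := hX.dist_le_mul x 0
  rw [dist_eq_norm, dist_zero_right] at h1
  have h2 := norm_le_norm_add_norm_sub' (X x) (X 0)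
  nlinarith [norm_nonneg x, norm_nonneg (X 0), K.coe_nonneg]

lemma tameField_comp (he : IsFlatCover e s) (hf : f ∈ LipVec e) : TameField (f ∘ e) := by
  obtain ⟨K, hK⟩ := exists_lipschitzWith_comp he hf
  obtain ⟨C, -, hC⟩ := hK.exists_linear_growth
  exact ⟨(hf.1.contDiff_comp).of_le ENat.LEInfty.out, C, hC⟩

lemma contDiff_lieBracket {E : Type*} [NormedAddCommGroup E] [NormedSpace ℝ E] {X Y : E → E}
    (hX : ContDiff ℝ ∞ X) (hY : ContDiff ℝ ∞ Y) : ContDiff ℝ ∞ (lieBracket ℝ X Y) :=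
  ((hY.fderiv_right (m := ∞) (by simp)).clm_apply hX).sub
    ((hX.fderiv_right (m := ∞) (by simp)).clm_apply hY)

/-- The bracket of two globally Lipschitz fields has linear growth, as their derivatives are
bounded; it need not be globally Lipschitz. -/
lemma tameField_bracket_comp (he : IsFlatCover e s) (hf : f ∈ LipVec e) (hg : g ∈ LipVec e) :
    TameField (bracket e f g ∘ e) := by
  rw [he.bracket_comp]
  obtain ⟨K, hK⟩ := exists_lipschitzWith_comp he hf
  obtain ⟨C, hC0, hC⟩ := hK.exists_linear_growth
  obtain ⟨K', hK'⟩ := exists_lipschitzWith_comp he hg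
  obtain ⟨C', hC'0, hC'⟩ := hK'.exists_linear_growth
  refine ⟨(contDiff_lieBracket (hf.1.contDiff_comp) (hg.1.contDiff_comp)).of_le
    ENat.LEInfty.out, K' * C + K * C', fun x => ?_⟩
  have h1 : ‖fderiv ℝ (g ∘ e) x ((f ∘ e) x)‖ ≤ K' * (C * (1 + ‖x‖)) :=
    ((fderiv ℝ (g ∘ e) x).le_opNorm _).trans
      (mul_le_mul (norm_fderiv_le_of_lipschitz ℝ hK') (hC x) (norm_nonneg _) K'.coe_nonneg)
  have h2 : ‖fderiv ℝ (f ∘ e) x ((g ∘ e) x)‖ ≤ K * (C' * (1 + ‖x‖)) :=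
    ((fderiv ℝ (f ∘ e) x).le_opNorm _).trans
      (mul_le_mul (norm_fderiv_le_of_lipschitz ℝ hK) (hC' x) (norm_nonneg _) K.coe_nonneg)
  refine (norm_sub_le _ _).trans ((add_le_add h1 h2).trans_eq (by ring))

/-! ### Flows on `M` and their lifts -/

/-- Every flow of a field on `M` is covered by the flow of the lifted field. -/
lemma IsFlow.apply_cover {φ : ℝ → M → M} (hφ : IsFlow e f φ) (he : IsFlatCover e s)
    (hf : ContDiff ℝ 1 (f ∘ e)) {p : ℝ → Eucl d → Eucl d} (hp : IsGlobalFlow (f ∘ e) p) (t : ℝ)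
    (x : Eucl d) : φ t (e x) = e (p t x) := by
  obtain ⟨h0, c, hc, hc'⟩ := hφ (e x)
  simp only [h0] at hc
  have hc0 : e (c 0) = 0 := by simpa [h0] using hc 0
  have hγ : ∀ r, e (x + (c r - c 0)) = φ r (e x) := fun r => by
    rw [he.map_add, he.map_sub, hc0, sub_zero, ← hc]
  have := hp.unique hf (γ := fun r => x + (c r - c 0)) (fun r => by
    rw [Function.comp_apply, hγ]
    exact ((hc' r).sub_const (c 0)).const_add x) t
  rw [← hγ, this, sub_self, add_zero]

/-- The flow of the lifted field descends to a flow on `M`. -/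
lemma IsGlobalFlow.isFlow (he : IsFlatCover e s) {p : ℝ → Eucl d → Eucl d}
    (hp : IsGlobalFlow (f ∘ e) p) : IsFlow e f fun t y => e (p t (s y)) := by
  refine fun y => ⟨by simp [hp.zero, he.apply_section], fun t => p t (s y) - s y, fun t => ?_,
    fun t => (hp.hasDerivAt (s y) t).sub_const (s y)⟩
  simp [hp.zero, he.map_sub]

lemma IsGlobalFlow.isCoverDiffeo (he : IsFlatCover e s) (hf : TameField (f ∘ e))
    (hf2 : ContDiff ℝ 2 (f ∘ e)) {p : ℝ → Eucl d → Eucl d} (hp : IsGlobalFlow (f ∘ e) p)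
    (t : ℝ) : IsCoverDiffeo e (p t) (p (-t)) where
  differentiable := hp.differentiable hf hf2 t
  differentiable_inv := hp.differentiable hf hf2 (-t)
  left_inv := hp.neg_apply hf.contDiff t
  right_inv := hp.apply_neg hf.contDiff t
  equivariant x k hk := by
    have := hp.unique hf.contDiff (γ := fun r => p r x + k) (fun r => by
      rw [Function.comp_apply, he.map_add, hk, add_zero]
      exact (hp.hasDerivAt x r).add_const k) t
    rw [this, hp.zero]

/-! ### Lifts of diffeomorphisms whose action on `L²` is `L²`-STAR -/

/-- `p` is the lift of a map of `M` that acts on `L²(M)` by an `L²`-STAR unitary operator. -/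
def IsSTARLift (e : Eucl d → M) (V : M → ℝ) (W : Fin m → M → ℝ) (p : Eucl d → Eucl d) : Prop :=
  Differentiable ℝ p ∧ ∃ (P : M → M) (L : LTwo M ≃ₗᵢ[ℂ] LTwo M), (∀ x, P (e x) = e (p x)) ∧
    Measure.QuasiMeasurePreserving P (volume : Measure M) volume ∧ IsTransport e P L ∧
      IsSTAR e V W L

lemma isSTARLift_id : IsSTARLift e V W id :=
  ⟨differentiable_id, id, _, fun _ => rfl, .id _, isTransport_id, isSTAR_refl⟩

lemma IsSTARLift.comp {p q : Eucl d → Eucl d} (hq : IsSTARLift e V W q)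
    (hp : IsSTARLift e V W p) : IsSTARLift e V W (q ∘ p) := by
  obtain ⟨dp, P, L, hP, mP, tP, sP⟩ := hp
  obtain ⟨dq, Q, L', hQ, mQ, tQ, sQ⟩ := hq
  exact ⟨dq.comp dp, Q ∘ P, L'.trans L, fun x => by simp [hP, hQ], mQ.comp mP, tP.trans mP tQ,
    sQ.trans sP⟩

lemma IsSTARLift.iterate {p : Eucl d → Eucl d} (hp : IsSTARLift e V W p) (n : ℕ) :
    IsSTARLift e V W p^[n] := by
  induction n with
  | zero => exact isSTARLift_id
  | succ n ih => exact ih.comp hp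

lemma HasSTARFlow.isSTARLift (h : HasSTARFlow e V W f) (he : IsFlatCover e s)
    (hf : TameField (f ∘ e)) (hf2 : ContDiff ℝ 2 (f ∘ e)) {p : ℝ → Eucl d → Eucl d}
    (hp : IsGlobalFlow (f ∘ e) p) (t : ℝ) : IsSTARLift e V W (p t) := by
  obtain ⟨φ, hφ, hL⟩ := h
  obtain ⟨L, hL, hS⟩ := hL t
  have hlift := fun x => hφ.apply_cover he hf.contDiff hp t x
  have hd := hp.isCoverDiffeo he hf hf2 t
  exact ⟨hd.differentiable, φ t, L, hlift, hd.quasiMeasurePreserving he hlift, hL, hS⟩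

/-- A field `X` has an `L²`-STAR flow if, for all real `t`, the time-one map of the flow of `t X` is
a limit of lifts of `L²`-STAR maps, pointwise together with the first derivatives. -/
lemma hasSTARFlow_of_tendsto [BorelSpace M] [(volume : Measure M).WeaklyRegular]
    (he : IsFlatCover e s) (hf : TameField (f ∘ e)) (hf2 : ContDiff ℝ 2 (f ∘ e))
    (h : ∀ (t : ℝ) (θ : ℝ → Eucl d → Eucl d), IsGlobalFlow (t • (f ∘ e)) θ →
      ∃ pₙ : ℕ → Eucl d → Eucl d, (∀ n, IsSTARLift e V W (pₙ n)) ∧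
        ∀ x, Tendsto (fun n => pₙ n x) atTop (𝓝 (θ 1 x)) ∧
          Tendsto (fun n => fderiv ℝ (pₙ n) x) atTop (𝓝 (fderiv ℝ (θ 1) x))) :
    HasSTARFlow e V W f := by
  obtain ⟨p, hp⟩ := hf.exists_isGlobalFlow
  obtain ⟨φ, hφ⟩ : ∃ φ, IsFlow e f φ := ⟨_, hp.isFlow he⟩
  refine ⟨φ, hφ, fun t => ?_⟩
  have hlift := fun x => hφ.apply_cover he hf.contDiff hp t x
  have hd := hp.isCoverDiffeo he hf hf2 t
  obtain ⟨L, hL⟩ := hd.exists_isTransport he hlift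
  obtain ⟨pₙ, hpₙ, hconv⟩ := h t _ (hp.smul t)
  simp only [mul_one] at hconv
  choose dₙ Pₙ Lₙ hliftₙ mₙ tₙ sₙ using hpₙ
  exact ⟨L, hL, .of_tendsto sₙ (tendsto_transport he hliftₙ hlift dₙ hd.differentiable mₙ
    (hd.quasiMeasurePreserving he hlift) tₙ hL (fun x => (hconv x).1) fun x => (hconv x).2)⟩

lemma zero_mem_starFields (he : IsFlatCover e s) : (0 : M → Eucl d) ∈ starFields e V W := by
  refine ⟨⟨fun y => contDiff_const, 0, LipschitzWith.const 0⟩, fun _ y => y,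
    fun y => ⟨rfl, 0, fun t => ?_, fun t => hasDerivAt_const t 0⟩,
    fun t => ⟨_, isTransport_id, isSTAR_refl⟩⟩
  rw [Pi.zero_apply, he.map_zero, add_zero]

lemma smul_mem_starFields (c : ℝ) (hf : f ∈ starFields e V W) : c • f ∈ starFields e V W := by
  obtain ⟨hf, φ, hφ, hL⟩ := hf
  refine ⟨smul_mem_lipVec c hf, fun t => φ (c * t), fun y => ⟨by simpa using (hφ y).1, ?_⟩,
    fun t => hL (c * t)⟩
  obtain ⟨-, γ, hγ, hγ'⟩ := hφ y
  refine ⟨fun t => γ (c * t), fun t => by simpa using hγ (c * t), fun t => ?_⟩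
  have := (hγ' (c * t)).scomp t ((hasDerivAt_id t).const_mul c)
  simpa [Function.comp_def] using this

lemma norm_fderiv_const_smul_le {E : Type*} [NormedAddCommGroup E] [NormedSpace ℝ E] {X : E → E}
    {K : ℝ} (hK : ∀ x, ‖fderiv ℝ X x‖ ≤ K) (t : ℝ) (x : E) :
    ‖fderiv ℝ (t • X) x‖ ≤ |t| * K := by
  rw [fderiv_const_smul_field, Pi.smul_apply, norm_smul, Real.norm_eq_abs]
  exact mul_le_mul_of_nonneg_left (hK x) (abs_nonneg t)

variable [BorelSpace M] [(volume : Measure M).WeaklyRegular]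

/-- The flow of `f + g` is given by the Lie-Trotter formula. -/
lemma add_mem_starFields (he : IsFlatCover e s) (hf : f ∈ starFields e V W)
    (hg : g ∈ starFields e V W) : f + g ∈ starFields e V W := by
  have hfg := add_mem_lipVec hf.1 hg.1
  have sf : ContDiff ℝ 2 (f ∘ e) := (hf.1.1.contDiff_comp).of_le ENat.LEInfty.out
  have sg : ContDiff ℝ 2 (g ∘ e) := (hg.1.1.contDiff_comp).of_le ENat.LEInfty.out
  have tf := tameField_comp he hf.1
  have tg := tameField_comp he hg.1
  have tfg := tameField_comp he hfg
  obtain ⟨p, hp⟩ := tf.exists_isGlobalFlow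
  obtain ⟨q, hq⟩ := tg.exists_isGlobalFlow
  obtain ⟨K, hK⟩ := exists_norm_fderiv_le he hf.1
  obtain ⟨K', hK'⟩ := exists_norm_fderiv_le he hg.1
  refine ⟨hfg, hasSTARFlow_of_tendsto he tfg (sf.add sg) fun t θ hθ => ?_⟩
  have hsum : t • ((f + g) ∘ e) = t • (f ∘ e) + t • (g ∘ e) := smul_add t (f ∘ e) (g ∘ e)
  have tt := tfg.const_smul t
  rw [hsum] at hθ tt
  refine ⟨fun n : ℕ => ((fun x => q (t * (1 / n)) x) ∘ fun x => p (t * (1 / n)) x)^[n],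
    fun n => ((hg.2.isSTARLift he tg sg hq _).comp (hf.2.isSTARLift he tf sf hp _)).iterate n,
    fun x => ?_⟩
  exact tendsto_trotter (tf.const_smul t) (tg.const_smul t) (sf.const_smul t) (sg.const_smul t)
    (norm_fderiv_const_smul_le hK t) (norm_fderiv_const_smul_le hK' t) (hp.smul t) (hq.smul t)
    tt hθ x

/-- The flow of `[f, g]` is given by the commutator formula; for time `t` it is applied to the pair
`(t f, g)`, as `t [f, g] = [t f, g]`. -/
lemma hasSTARFlow_bracket (he : IsFlatCover e s) (hf : f ∈ starFields e V W)
    (hg : g ∈ starFields e V W) : HasSTARFlow e V W (bracket e f g) := by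
  have sf : ContDiff ℝ 3 (f ∘ e) := (hf.1.1.contDiff_comp).of_le ENat.LEInfty.out
  have sg : ContDiff ℝ 3 (g ∘ e) := (hg.1.1.contDiff_comp).of_le ENat.LEInfty.out
  have sf2 : ContDiff ℝ 2 (f ∘ e) := sf.of_le (by norm_num)
  have sg2 : ContDiff ℝ 2 (g ∘ e) := sg.of_le (by norm_num)
  have tf := tameField_comp he hf.1
  have tg := tameField_comp he hg.1
  have tb := tameField_bracket_comp he hf.1 hg.1
  have sb : ContDiff ℝ 2 (bracket e f g ∘ e) := by
    rw [he.bracket_comp]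
    exact (contDiff_lieBracket (hf.1.1.contDiff_comp) (hg.1.1.contDiff_comp)).of_le
      ENat.LEInfty.out
  obtain ⟨p, hp⟩ := tf.exists_isGlobalFlow
  obtain ⟨q, hq⟩ := tg.exists_isGlobalFlow
  obtain ⟨K, hK⟩ := exists_norm_fderiv_le he hf.1
  obtain ⟨K', hK'⟩ := exists_norm_fderiv_le he hg.1
  refine hasSTARFlow_of_tendsto he tb sb fun t θ hθ => ?_
  have hbr : t • (bracket e f g ∘ e) = lieBracket ℝ (t • (f ∘ e)) (g ∘ e) := by
    rw [he.bracket_comp]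
    funext x
    simp only [lieBracket, Pi.smul_apply, fderiv_const_smul_field, map_smul, smul_sub]
    rfl
  have tt := tb.const_smul t
  rw [hbr] at hθ tt
  have Sp := hf.2.isSTARLift he tf sf2 hp
  have Sq := hg.2.isSTARLift he tg sg2 hq
  refine ⟨fun n : ℕ => ((fun x => q (-√(1 / n)) x) ∘ (fun x => p (t * -√(1 / n)) x) ∘
      (fun x => q √(1 / n) x) ∘ fun x => p (t * √(1 / n)) x)^[n],
    fun n => ((Sq _).comp ((Sp _).comp ((Sq _).comp (Sp _)))).iterate n, fun x => ?_⟩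
  exact tendsto_commutator (tf.const_smul t) tg (sf.const_smul t) sg
    (norm_fderiv_const_smul_le hK t) hK' (hp.smul t) hq tt hθ x

end STARFields

/-! ### The two covers -/

section Covers

open scoped NNReal

lemma isFlatCover_eucl (d : ℕ) : IsFlatCover (euclExp d) (euclExp d) where
  map_add _ _ := rfl
  lipschitz := LipschitzWith.id
  eventually_eq_zero := Eventually.of_forall fun _ hv => hv
  countable_ker := Set.countable_singleton 0
  measurable_section := measurable_id
  apply_section _ := rfl
  measurableSet_range := by
    have : Set.range (euclExp d) = Set.univ := Set.range_id
    rw [this]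
    exact .univ
  measurePreserving := by
    have : Set.range (euclExp d) = Set.univ := Set.range_id
    rw [this, Measure.restrict_univ]
    exact .id _

/-- The section of `ℝᵈ → 𝕋ᵈ` with values in the box `(0, 2π]ᵈ`. -/
noncomputable def torusSection (d : ℕ) (y : Torus d) : Eucl d :=
  WithLp.toLp 2 fun i => (AddCircle.measurableEquivIoc (2 * π) 0 (y i) : ℝ)

lemma torusExp_torusSection (d : ℕ) (y : Torus d) : torusExp d (torusSection d y) = y :=
  funext fun i => (AddCircle.measurableEquivIoc (2 * π) 0).symm_apply_apply (y i)

lemma range_torusSection (d : ℕ) : Set.range (torusSection d) =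
    WithLp.ofLp ⁻¹' Set.univ.pi fun _ : Fin d => Set.Ioc 0 (0 + 2 * π) := by
  ext x
  simp only [Set.mem_range, Set.mem_preimage, Set.mem_univ_pi]
  constructor
  · rintro ⟨y, rfl⟩ i
    exact (AddCircle.measurableEquivIoc (2 * π) 0 (y i)).2
  · intro hx
    refine ⟨torusExp d x, PiLp.ext fun i => ?_⟩
    have := (AddCircle.measurableEquivIoc (2 * π) 0).apply_symm_apply ⟨x i, hx i⟩
    exact congrArg Subtype.val this

lemma exists_coe_eq_abs_eq_norm (z : AddCircle (2 * π)) :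
    ∃ r : ℝ, (r : AddCircle (2 * π)) = z ∧ |r| = ‖z‖ := by
  obtain ⟨x, rfl⟩ := QuotientAddGroup.mk_surjective z
  refine ⟨x - round ((2 * π)⁻¹ * x) * (2 * π), ?_, (AddCircle.norm_eq _).symm⟩
  have h0 : ((round ((2 * π)⁻¹ * x) * (2 * π) : ℝ) : AddCircle (2 * π)) = 0 :=
    (AddCircle.coe_eq_zero_iff _).2 ⟨_, zsmul_eq_mul _ _⟩
  change ((x - round ((2 * π)⁻¹ * x) * (2 * π) : ℝ) : AddCircle (2 * π)) = (x : AddCircle (2 * π))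
  rw [AddCircle.coe_sub, h0, sub_zero]

lemma isFlatCover_torus (d : ℕ) : IsFlatCover (torusExp d) (torusSection d) where
  map_add x y := rfl
  lipschitz := by
    have h : LipschitzWith 1 fun (x : Fin d → ℝ) i => (x i : AddCircle (2 * π)) := by
      refine LipschitzWith.of_dist_le_mul fun x y => ?_
      rw [NNReal.coe_one, one_mul]
      refine (dist_pi_le_iff dist_nonneg).2 fun i => ?_
      refine le_trans ?_ (dist_le_pi_dist x y i)
      rw [dist_eq_norm, dist_eq_norm, ← AddCircle.coe_sub]
      exact QuotientAddGroup.norm_mk_le_norm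
    have := h.comp (PiLp.lipschitzWith_ofLp 2 fun _ : Fin d => ℝ)
    rw [mul_one] at this
    exact this
  eventually_eq_zero := by
    filter_upwards [Metric.ball_mem_nhds (0 : Eucl d) two_pi_pos] with v hv h0
    refine PiLp.ext fun i => ?_
    obtain ⟨n, hn⟩ := (AddCircle.coe_eq_zero_iff _).1 (congrFun h0 i : (v i : AddCircle (2 * π)) = 0)
    have h1 : |v i| < 2 * π := by
      rw [mem_ball_zero_iff] at hv
      exact (PiLp.norm_apply_le v i).trans_lt hv
    rw [← hn, zsmul_eq_mul, abs_mul, abs_of_pos two_pi_pos] at h1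
    have h2 : |(n : ℝ)| < 1 := by
      by_contra! h
      nlinarith [two_pi_pos]
    have h3 : n = 0 := Int.abs_lt_one_iff.1 (by exact_mod_cast h2)
    rw [← hn, h3, zero_smul]
    rfl
  countable_ker := by
    refine (Set.countable_range fun (n : Fin d → ℤ) =>
      (WithLp.toLp 2 fun i => n i • (2 * π) : Eucl d)).mono fun k hk => ?_
    choose n hn using fun i => (AddCircle.coe_eq_zero_iff _).1
      (congrFun hk i : (k i : AddCircle (2 * π)) = 0)
    exact ⟨n, PiLp.ext hn⟩
  measurable_section := (WithLp.measurable_toLp 2 _).comp (measurable_pi_lambda _ fun i =>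
    measurable_subtype_coe.comp ((AddCircle.measurableEquivIoc (2 * π) 0).measurable.comp
      (measurable_pi_apply i)))
  apply_section := torusExp_torusSection d
  measurableSet_range := by
    rw [range_torusSection]
    exact WithLp.measurable_ofLp 2 _ (MeasurableSet.univ_pi fun _ => measurableSet_Ioc)
  measurePreserving := by
    have h1 := (PiLp.volume_preserving_ofLp (Fin d)).restrict_preimage
      (MeasurableSet.univ_pi fun _ : Fin d => measurableSet_Ioc (a := (0 : ℝ)) (b := 0 + 2 * π))
    have h2 := measurePreserving_pi (fun _ : Fin d => volume.restrict (Set.Ioc (0 : ℝ) (0 + 2 * π)))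
      (fun _ => volume) fun _ => AddCircle.measurePreserving_mk (2 * π) 0
    rw [← Measure.restrict_pi_pi] at h2
    rw [range_torusSection]
    exact h2.comp h1

/-- By compactness, smooth maps on the torus are globally Lipschitz. -/
lemma IsSmooth.exists_lipschitzWith_torus {d : ℕ} {f : Torus d → Eucl d}
    (hf : IsSmooth (torusExp d) f) : ∃ K, LipschitzWith K f := by
  have he := isFlatCover_torus d
  have hX : ContDiff ℝ 1 (f ∘ torusExp d) := hf.contDiff_comp.of_le ENat.LEInfty.out
  -- the box of the section is bounded, and the derivative of the lift is periodic
  obtain ⟨C, hC⟩ := (isCompact_closedBall (0 : Eucl d)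
    (√(d : ℝ) * (2 * π))).exists_bound_of_continuousOn
    (hX.continuous_fderiv one_ne_zero).continuousOn
  have hbd : ∀ x, ‖fderiv ℝ (f ∘ torusExp d) x‖ ≤ C := by
    intro x
    have hper : fderiv ℝ (f ∘ torusExp d) x =
        fderiv ℝ (f ∘ torusExp d) (torusSection d (torusExp d x)) := by
      rw [← he.fderiv_chart, ← he.fderiv_chart, torusExp_torusSection]
    rw [hper]
    refine hC _ ?_
    rw [mem_closedBall_zero_iff, EuclideanSpace.norm_eq]
    have hle : ∑ i, ‖torusSection d (torusExp d x) i‖ ^ 2 ≤ d * (2 * π) ^ 2 := by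
      have hi : ∀ i ∈ Finset.univ, ‖torusSection d (torusExp d x) i‖ ^ 2 ≤ (2 * π) ^ 2 := by
        intro i _
        have hmem : torusSection d (torusExp d x) ∈ Set.range (torusSection d) := ⟨_, rfl⟩
        rw [range_torusSection] at hmem
        have h := hmem i (Set.mem_univ i)
        rw [zero_add] at h
        rw [Real.norm_eq_abs, sq_abs]
        exact pow_le_pow_left₀ h.1.le h.2 2
      simpa using Finset.sum_le_card_nsmul _ _ _ hi
    calc √(∑ i, ‖torusSection d (torusExp d x) i‖ ^ 2) ≤ √(d * (2 * π) ^ 2) :=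
          Real.sqrt_le_sqrt hle
      _ = √(d : ℝ) * (2 * π) := by
        rw [Real.sqrt_mul (Nat.cast_nonneg d), Real.sqrt_sq two_pi_pos.le]
  have hlip : LipschitzWith C.toNNReal (f ∘ torusExp d) :=
    lipschitzWith_of_nnnorm_fderiv_le (hX.differentiable one_ne_zero) fun x => by
      rw [← NNReal.coe_le_coe, coe_nnnorm]
      exact (hbd x).trans (le_coe_toNNReal C)
  set c : ℝ≥0 := (Fintype.card (Fin d) : ℝ≥0) ^ (1 / (2 : ENNReal)).toReal
  refine ⟨C.toNNReal * c, LipschitzWith.of_dist_le_mul fun y y' => ?_⟩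
  -- a short displacement `v` in `ℝᵈ` that leads from `y'` to `y`
  choose v hv hvn using fun i => exists_coe_eq_abs_eq_norm ((y - y') i)
  have hy : y = torusExp d (torusSection d y' + WithLp.toLp 2 v) := by
    rw [he.map_add, torusExp_torusSection]
    have : torusExp d (WithLp.toLp 2 v) = y - y' := funext hv
    rw [this, add_sub_cancel]
  have h1 := hlip.dist_le_mul (torusSection d y' + WithLp.toLp 2 v) (torusSection d y')
  simp only [Function.comp_apply] at h1
  rw [← hy, torusExp_torusSection, dist_eq_norm (_ + _), add_sub_cancel_left] at h1
  have h2 : ‖(WithLp.toLp 2 v : Eucl d)‖ ≤ c * dist y y' := by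
    have := (PiLp.lipschitzWith_toLp 2 fun _ : Fin d => ℝ).dist_le_mul v 0
    rw [WithLp.toLp_zero, dist_zero_right, dist_zero_right] at this
    refine this.trans (mul_le_mul_of_nonneg_left ?_ (NNReal.coe_nonneg c))
    rw [dist_eq_norm]
    refine (pi_norm_le_iff_of_nonneg (norm_nonneg _)).2 fun i => ?_
    rw [Real.norm_eq_abs, hvn]
    exact norm_le_pi_norm _ i
  rw [NNReal.coe_mul, mul_assoc]
  exact h1.trans (mul_le_mul_of_nonneg_left h2 (NNReal.coe_nonneg _))

lemma bracket_mem_lipVec_torus {d : ℕ} {f g : Torus d → Eucl d} (hf : f ∈ LipVec (torusExp d))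
    (hg : g ∈ LipVec (torusExp d)) : bracket (torusExp d) f g ∈ LipVec (torusExp d) := by
  have he := isFlatCover_torus d
  have hs : IsSmooth (torusExp d) (bracket (torusExp d) f g) := he.isSmooth (by
    rw [he.bracket_comp]
    exact contDiff_lieBracket hf.1.contDiff_comp hg.1.contDiff_comp)
  exact ⟨hs, hs.exists_lipschitzWith_torus⟩

end Covers

theorem theorem8 (d m : ℕ) :
    (∀ (V : Torus d → ℝ) (W : Fin m → Torus d → ℝ),
      ∃ S : Submodule ℝ (Torus d → Eucl d),
        (S : Set (Torus d → Eucl d)) = starFields (torusExp d) V W ∧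
        ∀ f ∈ S, ∀ g ∈ S, bracket (torusExp d) f g ∈ S) ∧
    (∀ (V : Eucl d → ℝ) (W : Fin m → Eucl d → ℝ),
      ∃ S : Submodule ℝ (Eucl d → Eucl d),
        (S : Set (Eucl d → Eucl d)) = starFields (euclExp d) V W ∧
        ∀ f ∈ S, ∀ g ∈ S, HasSTARFlow (euclExp d) V W (bracket (euclExp d) f g) ∧
          (bracket (euclExp d) f g ∈ LipVec (euclExp d) → bracket (euclExp d) f g ∈ S)) := by
  have ht := isFlatCover_torus d
  have he := isFlatCover_eucl d
  refine ⟨fun V W => ⟨⟨⟨⟨starFields (torusExp d) V W, add_mem_starFields ht⟩,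
      zero_mem_starFields ht⟩, fun c _ => smul_mem_starFields c⟩, rfl, fun f hf g hg =>
      ⟨bracket_mem_lipVec_torus hf.1 hg.1, hasSTARFlow_bracket ht hf hg⟩⟩,
    fun V W => ⟨⟨⟨⟨starFields (euclExp d) V W, add_mem_starFields he⟩,
      zero_mem_starFields he⟩, fun c _ => smul_mem_starFields c⟩, rfl, fun f hf g hg =>
      ⟨hasSTARFlow_bracket he hf hg, fun h => ⟨h, hasSTARFlow_bracket he hf hg⟩⟩⟩⟩
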